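/- Fix a finite alphabet $\Sigma$. A *quantitative automaton* $\mathcal A=(\Sigma,Q,\iota,\delta)$ has a finite set $Q$ of states, an initial state $\iota\in Q$, and a transition function assigning to each $(q,\sigma)\in Q\times\Sigma$ a finite nonempty set $\delta(q,\sigma)$ of pairs $(x,q')\in\mathbb Q\times Q$ (weight, successor state); it is *deterministic* if every $\delta(q,\sigma)$ is a singleton. A run of $\mathcal A$ on an infinite word $w\in\Sigma^\omega$ is a sequence of states $q_0=\iota,q_1,\dots$ and weights $x_0,x_1,\dots$ with $(x_i,q_{i+1})\in\delta(q_i,w[i])$ for all $i$. As a *$\mathrm{Sup}$-automaton* (respectively *$\mathrm{Inf}$-automaton*), $\mathcal A$ gives a run the value $\sup_i x_i$ (respectively $\inf_i x_i$), and $\mathcal A(w)$ is the supremum of the values of the runs of $\mathcal A$ on $w$. For a function $\Phi$ from $\Sigma^\omega$ to the extended reals: * $\Phi$ is *safe* if for every word $w$ and every value $v>\Phi(w)$ there is a finite prefix $u$ of $w$ with $\sup_{w'\in\Sigma^\omega}\Phi(uw')<v$; * $\Phi$ is *live* if for every word $w$ with $\Phi(w)<\sup_{w'\in\Sigma^\omega}\Phi(w')$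 there is a value $v>\Phi(w)$ such that $\sup_{w'\in\Sigma^\omega}\Phi(uw')\ge v$ for every finite prefix $u$ of $w$. An automaton is called safe or live if the function $w\mapsto\mathcal A(w)$ is. The size of an automaton is the maximum of the size of its alphabet, the number of its states and the size of its transition table, where weights are written in binary. **Theorem.** There is an algorithm (a multi-tape Turing machine) that, given any deterministic $\mathrm{Sup}$-automaton $\mathcal A$ over any finite alphabet $\Sigma$, constructs, in time polynomial in the size of $\mathcal A$, a deterministic safe $\mathrm{Inf}$-automaton $\mathcal B$ and a deterministic live $\mathrm{Sup}$-automaton $\mathcal C$ over $\Sigma$ such that $$\mathcal A(w)=\min(\mathcal B(w),\mathcal C(w))\qquad\text{for every infinite word } w\in\Sigma^\omega .$$ -/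

import Mathlib

open Computability Turing

/-! ### Quantitative properties, safety and liveness -/

/-- The infinite word `u w'`, where `u = w[0] ⋯ w[n-1]` is the prefix of `w` of length `n`. -/
def prefixAppend {S : Type} (w : ℕ → S) (n : ℕ) (w' : ℕ → S) : ℕ → S :=
  fun i => if i < n then w i else w' (i - n)

/-- A quantitative property `Φ` is safe when for every infinite word `w` and every value `v` with
`Φ w ≱ v` there is a finite prefix `u` of `w` with `sup_{w'} Φ (u w') ≱ v`. -/
def IsSafe {S D : Type} [CompleteLattice D] (Φ : (ℕ → S) → D) : Prop :=
  ∀ (w : ℕ → S) (v : D), ¬ v ≤ Φ w → ∃ n : ℕ, ¬ v ≤ ⨆ w' : ℕ → S, Φ (prefixAppend w n w')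

/-- The top value of a property: the supremum of its values. -/
def topValue {S D : Type} [CompleteLattice D] (Φ : (ℕ → S) → D) : D :=
  ⨆ w : ℕ → S, Φ w

/-- A quantitative property `Φ` is live when for every infinite word `w` with `Φ w < ⊤` there is
a value `v` with `Φ w ≱ v` such that `sup_{w'} Φ (u w') ≥ v` for every finite prefix `u` of `w`.
Here `⊤` is the top value of `Φ`: the value domain of a property is always taken so that its
greatest element is the top value of the property. -/
def IsLive {S D : Type} [CompleteLattice D] (Φ : (ℕ → S) → D) : Prop :=
  ∀ w : ℕ → S, Φ w < topValue Φ →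
    ∃ v : D, ¬ v ≤ Φ w ∧ ∀ n : ℕ, v ≤ ⨆ w' : ℕ → S, Φ (prefixAppend w n w')

/-! ### Quantitative automata -/

/-- A (nondeterministic, total) quantitative automaton with alphabet `S` and states `Q`; the
transitions from state `q` on letter `a` are the pairs (weight, successor state) in `δ q a`. -/
structure QuantAut (S Q : Type) where
  /-- initial state -/
  init : Q
  /-- transition function -/
  δ : Q → S → Finset (ℚ × Q)
  /-- there is a transition from every state on every letter -/
  total : ∀ q a, (δ q a).Nonempty

namespace QuantAut

variable {S Q : Type}

/-- Exactly one transition from every state on every letter. -/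
def IsDeterministic (A : QuantAut S Q) : Prop :=
  ∀ q a, ∃ t, A.δ q a = {t}

/-- The states `q 0, q 1, …` and the weights `x 0, x 1, …` form a run of `A` on the word `w`. -/
def IsRun (A : QuantAut S Q) (w : ℕ → S) (q : ℕ → Q) (x : ℕ → ℚ) : Prop :=
  q 0 = A.init ∧ ∀ i, (x i, q (i + 1)) ∈ A.δ (q i) (w i)

/-- The value of a word: the supremum, over all runs on it, of the value of the weight sequence
under the value function `Val`. -/
noncomputable def value (Val : (ℕ → ℚ) → EReal) (A : QuantAut S Q) (w : ℕ → S) : EReal :=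
  ⨆ (q : ℕ → Q) (x : ℕ → ℚ) (_ : A.IsRun w q x), Val x

end QuantAut

/-- The value function `Inf`. -/
noncomputable def infVal (x : ℕ → ℚ) : EReal := ⨅ i, ((x i : ℝ) : EReal)

/-- The value function `Sup`. -/
noncomputable def supVal (x : ℕ → ℚ) : EReal := ⨆ i, ((x i : ℝ) : EReal)

/-- A deterministic quantitative automaton over the alphabet `{0, …, k-1}`, with finitely many
states `{0, …, numStates-1}`. -/
structure DetAut (k : ℕ) where
  /-- number of states -/
  numStates : ℕ
  /-- the automaton -/
  aut : QuantAut (Fin k) (Fin numStates)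
  /-- it is deterministic -/
  det : aut.IsDeterministic

namespace DetAut

variable {k : ℕ}

/-- The unique transition (weight, successor) from state `q` on letter `a`. -/
noncomputable def trans (A : DetAut k) (q : Fin A.numStates) (a : Fin k) :
    ℚ × Fin A.numStates :=
  (A.det q a).choose

theorem δ_eq (A : DetAut k) (q : Fin A.numStates) (a : Fin k) :
    A.aut.δ q a = {A.trans q a} :=
  (A.det q a).choose_spec

end DetAut

/-! ### Encoding of deterministic automata as strings

Alphabet size, number of states and names of states are written in unary, weights in binary, so
that the length of the encoding is polynomially related to the maximum of the number of letters,
the number of states and the size of the transition table with weights in binary. -/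

/-- `n` in unary, followed by a comma. -/
def encUnary (n : ℕ) : List Γ' :=
  List.replicate n (Γ'.bit true) ++ [Γ'.comma]

/-- `n` in binary (least significant bit first), followed by a comma. -/
def encBinary (n : ℕ) : List Γ' :=
  (encodeNat n).map Γ'.bit ++ [Γ'.comma]

/-- A rational in lowest terms: its sign, the absolute value of the numerator, the denominator. -/
def encRat (x : ℚ) : List Γ' :=
  Γ'.bit (decide (x < 0)) :: (encBinary x.num.natAbs ++ encBinary x.den)

/-- A deterministic automaton: the number of letters, the number of states, the initial state,
and for every state and every letter the weight and the successor of the transition. -/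
noncomputable def encAut {k : ℕ} (A : DetAut k) : List Γ' :=
  encUnary k ++ (encUnary A.numStates ++ (encUnary A.aut.init ++
    (List.finRange A.numStates).flatMap fun q => (List.finRange k).flatMap fun a =>
      encRat (A.trans q a).1 ++ encUnary (A.trans q a).2))

/-- Encoding of a deterministic automaton over an alphabet of arbitrary finite size. -/
noncomputable def encInput (A : Σ k : ℕ, DetAut k) : List Γ' :=
  encAut A.2

/-- Encoding of a pair of deterministic automata over the same alphabet. -/
noncomputable def encOutput (P : Σ k : ℕ, DetAut k × DetAut k) : List Γ' :=
  encAut P.2.1 ++ encAut P.2.2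

/-! The encodings are injective. -/

theorem comma_append_inj {l l' r s : List Γ'} (hl : Γ'.comma ∉ l) (hl' : Γ'.comma ∉ l')
    (h : l ++ [Γ'.comma] ++ r = l' ++ [Γ'.comma] ++ s) : l = l' ∧ r = s := by
  induction l generalizing l' with
  | nil =>
    cases l' with
    | nil => simpa using h
    | cons b l' =>
      simp only [List.cons_append, List.nil_append, List.cons.injEq] at h
      exact absurd (h.1 ▸ List.mem_cons_self) hl'
  | cons a l ih =>
    cases l' with
    | nil =>
      simp only [List.cons_append, List.nil_append, List.cons.injEq] at h
      exact absurd (h.1 ▸ List.mem_cons_self) hl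
    | cons b l' =>
      simp only [List.cons_append, List.cons.injEq] at h
      simp only [List.mem_cons, not_or] at hl hl'
      obtain ⟨h1, h2⟩ := ih hl.2 hl'.2 h.2
      exact ⟨by rw [h.1, h1], h2⟩

theorem encUnary_append_inj {m n : ℕ} {r s : List Γ'}
    (h : encUnary m ++ r = encUnary n ++ s) : m = n ∧ r = s := by
  obtain ⟨h1, h2⟩ := comma_append_inj (by simp [List.mem_replicate])
    (by simp [List.mem_replicate]) h
  exact ⟨by simpa using congrArg List.length h1, h2⟩

theorem encBinary_append_inj {m n : ℕ} {r s : List Γ'}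
    (h : encBinary m ++ r = encBinary n ++ s) : m = n ∧ r = s := by
  obtain ⟨h1, h2⟩ := comma_append_inj (by simp) (by simp) h
  refine ⟨encodingNatBool.encode_injective ?_, h2⟩
  exact List.map_injective_iff.mpr (fun a b hab => by simpa using hab) h1

theorem encRat_append_inj {x y : ℚ} {r s : List Γ'}
    (h : encRat x ++ r = encRat y ++ s) : x = y ∧ r = s := by
  simp only [encRat, List.cons_append, List.append_assoc, List.cons.injEq, Γ'.bit.injEq,
    decide_eq_decide] at h
  obtain ⟨hs, h⟩ := h
  obtain ⟨h1, h⟩ := encBinary_append_inj h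
  obtain ⟨h2, h⟩ := encBinary_append_inj h
  refine ⟨Rat.ext ?_ h2, h⟩
  rw [← Rat.num_neg, ← Rat.num_neg] at hs
  omega

theorem flatMap_append_inj {α : Type} {e f : α → List Γ'} (L : List α)
    (P : α → Prop)
    (he : ∀ a r s, e a ++ r = f a ++ s → P a ∧ r = s) {r s : List Γ'}
    (h : L.flatMap e ++ r = L.flatMap f ++ s) : (∀ a ∈ L, P a) ∧ r = s := by
  induction L with
  | nil => simpa using h
  | cons a L ih =>
    simp only [List.flatMap_cons, List.append_assoc] at h
    obtain ⟨h1, h2⟩ := he _ _ _ h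
    obtain ⟨h3, h4⟩ := ih h2
    exact ⟨by simpa [h1] using h3, h4⟩

theorem encAut_append_inj {k : ℕ} {A B : DetAut k} {r s : List Γ'}
    (h : encAut A ++ r = encAut B ++ s) : A = B ∧ r = s := by
  simp only [encAut, List.append_assoc] at h
  obtain ⟨-, h⟩ := encUnary_append_inj h
  obtain ⟨hn, h⟩ := encUnary_append_inj h
  obtain ⟨n, A, hA⟩ := A
  obtain ⟨m, B, hB⟩ := B
  simp only at hn
  subst hn
  obtain ⟨hi, h⟩ := encUnary_append_inj h
  obtain ⟨ht, h⟩ := flatMap_append_inj _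
    (fun q => ∀ a ∈ List.finRange k,
      (DetAut.mk n A hA).trans q a = (DetAut.mk n B hB).trans q a)
    (fun q r s hq => flatMap_append_inj _ _ (fun a r s ha => by
      simp only [List.append_assoc] at ha
      obtain ⟨h1, ha⟩ := encRat_append_inj ha
      obtain ⟨h2, ha⟩ := encUnary_append_inj ha
      exact ⟨Prod.ext h1 (Fin.ext h2), ha⟩) hq) h
  refine ⟨?_, h⟩
  have hδ : A.δ = B.δ := by
    funext q a
    have := ht q (List.mem_finRange q) a (List.mem_finRange a)
    rw [(DetAut.mk n A hA).δ_eq q a, (DetAut.mk n B hB).δ_eq q a, this]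
  have hAB : A = B := by
    obtain ⟨iA, dA, tA⟩ := A
    obtain ⟨iB, dB, tB⟩ := B
    simp only at hδ hi
    subst hδ
    obtain rfl : iA = iB := Fin.ext hi
    rfl
  subst hAB
  rfl

theorem encInput_injective : Function.Injective encInput := by
  rintro ⟨k, A⟩ ⟨l, B⟩ h
  change encAut A = encAut B at h
  obtain ⟨rfl, -⟩ := encUnary_append_inj h
  obtain ⟨rfl, -⟩ := encAut_append_inj (congrArg (· ++ []) h)
  rfl

theorem encOutput_injective : Function.Injective encOutput := by
  rintro ⟨k, A, A'⟩ ⟨l, B, B'⟩ h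
  change encAut A ++ encAut A' = encAut B ++ encAut B' at h
  have h0 := h
  rw [encAut, encAut.eq_def B, List.append_assoc, List.append_assoc (encUnary l)] at h0
  obtain ⟨rfl, -⟩ := encUnary_append_inj h0
  obtain ⟨rfl, h1⟩ := encAut_append_inj h
  obtain ⟨rfl, -⟩ := encAut_append_inj (congrArg (· ++ []) h1)
  rfl

/-! Along the run of a deterministic `Sup`-automaton on `w`, let `m` be the largest weight read so
far, `q` the current state and `best q` the largest weight on a transition reachable from `q`. The
safety component emits `max m (best q)`, the least upper bound for all continuations, and takes the
infimum. The liveness component emits the running maximum until `best q ≤ m`, when no continuation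
can improve on it, and the top weight from then on.

Deterministic `Inf`-automata are safe because a value below `v` is caused by a single weight, which
a finite prefix fixes (`isSafe_infVal`). The second component is live because every prefix extends
to a word attaining the best weight still reachable, and such a word has the top value
(`isLive_live`). If the run of `w` ever reaches `best q ≤ m`, the first component has the value of
the automaton and the second has the top value; otherwise the second has the value of the automaton
and the first is at least as large (`value_eq_min`).

To keep `m` in the state with polynomially many states, weights are replaced by ranks: the rank of a
transition counts the transitions of at most its weight (`rank_le_rank_iff`). The best ranks are the
fixed point of a monotone iteration that stabilizes after polynomially many rounds
(`le_sum_bestUpTo_or`, `best_eq_sup`).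

For the running time, structured programs on five stacks compile to Turing machines (`Run.reaches`,
`computable_of_run`). All data are binary trees serialized on one stack, and the class `PolyTime` of
functions on them is closed under composition, pairing, case distinction and folds with polynomially
bounded intermediate results (`foldl_of_bound`). The construction is written with these operations
on the tokens of the input, and `map_outSymb` identifies the resulting string with the encoding of
the product automaton. -/

/-! ### Structured programs over stacks -/

/-- The stacks of the machine: a main stack of serialized trees, two auxiliary stacks, a unary
counter, and a stack for input and output. -/
inductive Stk
  | main | x | y | cnt | io
  deriving DecidableEq

instance : Fintype Stk :=
  ⟨{.main, .x, .y, .cnt, .io}, by rintro ⟨⟩ <;> simp⟩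

/-- Structured programs: the register holds the symbol popped last. -/
inductive Prog
  | skip
  | push (k : Stk) (f : Option Γ' → Γ')
  | pop (k : Stk)
  | seq (p q : Prog)
  | ite (c : Option Γ' → Bool) (p q : Prog)
  | while (c : Option Γ' → Bool) (p : Prog)

namespace Prog

open Function (update)

/-- `Run p v s n v' s'`: started with register `v` and stacks `s`, the program `p` terminates
within `n` steps with register `v'` and stacks `s'`. -/
inductive Run : Prog → Option Γ' → (Stk → List Γ') → ℕ → Option Γ' → (Stk → List Γ') → Prop
  | skip {v s n} (hn : 1 ≤ n) : Run skip v s n v s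
  | push {k f v s n} (hn : 1 ≤ n) : Run (push k f) v s n v (update s k (f v :: s k))
  | pop {k v s n} (hn : 1 ≤ n) : Run (pop k) v s n (s k).head? (update s k (s k).tail)
  | seq {p q v s v₁ s₁ v₂ s₂ n₁ n₂ n} (h₁ : Run p v s n₁ v₁ s₁) (h₂ : Run q v₁ s₁ n₂ v₂ s₂)
      (hn : n₁ + n₂ ≤ n) : Run (seq p q) v s n v₂ s₂
  | ite_true {c p q v s v₁ s₁ n₁ n} (hc : c v = true) (h : Run p v s n₁ v₁ s₁)
      (hn : n₁ + 1 ≤ n) : Run (ite c p q) v s n v₁ s₁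
  | ite_false {c p q v s v₁ s₁ n₁ n} (hc : c v = false) (h : Run q v s n₁ v₁ s₁)
      (hn : n₁ + 1 ≤ n) : Run (ite c p q) v s n v₁ s₁
  | while_false {c p v s n} (hc : c v = false) (hn : 1 ≤ n) : Run (Prog.while c p) v s n v s
  | while_true {c p v s v₁ s₁ v₂ s₂ n₁ n₂ n} (hc : c v = true) (h₁ : Run p v s n₁ v₁ s₁)
      (h₂ : Run (Prog.while c p) v₁ s₁ n₂ v₂ s₂) (hn : n₁ + n₂ + 1 ≤ n) :
      Run (Prog.while c p) v s n v₂ s₂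

theorem Run.mono {p v s n v' s' m} (h : Run p v s n v' s') (hm : n ≤ m) : Run p v s m v' s' := by
  cases h with
  | skip h => exact .skip (h.trans hm)
  | push h => exact .push (h.trans hm)
  | pop h => exact .pop (h.trans hm)
  | seq h₁ h₂ h => exact .seq h₁ h₂ (h.trans hm)
  | ite_true hc h₁ h => exact .ite_true hc h₁ (h.trans hm)
  | ite_false hc h₁ h => exact .ite_false hc h₁ (h.trans hm)
  | while_false hc h => exact .while_false hc (h.trans hm)
  | while_true hc h₁ h₂ h => exact .while_true hc h₁ h₂ (h.trans hm)

/-! ### Compilation to stack machines -/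

/-- The labels of the compiled program. -/
def Lab : Prog → Type
  | skip | push _ _ | pop _ => Unit
  | seq p q => Lab p ⊕ Lab q
  | ite _ p q => Option (Lab p ⊕ Lab q)
  | Prog.while _ p => Option (Lab p)

/-- The label where the compiled program starts. -/
def entry : (p : Prog) → Lab p
  | skip | push _ _ | pop _ => ()
  | seq p _ => Sum.inl (entry p)
  | ite _ _ _ => none
  | Prog.while _ _ => none

noncomputable instance Lab.fintype : (p : Prog) → Fintype (Lab p)
  | skip | push _ _ | pop _ => inferInstanceAs (Fintype Unit)
  | seq p q =>
    have := Lab.fintype p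
    have := Lab.fintype q
    inferInstanceAs (Fintype (Lab p ⊕ Lab q))
  | ite _ p q =>
    have := Lab.fintype p
    have := Lab.fintype q
    inferInstanceAs (Fintype (Option (Lab p ⊕ Lab q)))
  | Prog.while _ p =>
    have := Lab.fintype p
    inferInstanceAs (Fintype (Option (Lab p)))

/-- Statements of the compiled programs. -/
abbrev MStmt (Λ : Type) := TM2.Stmt (fun _ : Stk => Γ') Λ (Option Γ')

/-- The statement at a label of the compiled program, where labels are embedded by `emb` and
control leaves the program to the label `exit`. -/
def code {Λ : Type} : (p : Prog) → (emb : Lab p → Λ) → (exit : Λ) → Lab p → MStmt Λ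
  | skip, _, exit, _ => .goto fun _ => exit
  | push k f, _, exit, _ => .push k f (.goto fun _ => exit)
  | pop k, _, exit, _ => .pop k (fun _ a => a) (.goto fun _ => exit)
  | seq p q, emb, exit, l => match l with
    | Sum.inl l => code p (fun l => emb (Sum.inl l)) (emb (Sum.inr (entry q))) l
    | Sum.inr l => code q (fun l => emb (Sum.inr l)) exit l
  | ite c p q, emb, exit, l => match l with
    | none => .branch c (.goto fun _ => emb (some (Sum.inl (entry p))))
        (.goto fun _ => emb (some (Sum.inr (entry q))))
    | some (Sum.inl l) => code p (fun l => emb (some (Sum.inl l))) exit l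
    | some (Sum.inr l) => code q (fun l => emb (some (Sum.inr l))) exit l
  | Prog.while c p, emb, exit, l => match l with
    | none => .branch c (.goto fun _ => emb (some (entry p))) (.goto fun _ => exit)
    | some l => code p (fun l => emb (some l)) (emb none) l

/-- Induction on the run, with the machine, the label embedding and the exit label left general: a
subprogram then runs inside the larger machine, with its exit placed at the entry of whatever
follows. The unit added for each guard pays for its branch statement. -/
theorem Run.reaches {p v s n v' s'} (h : Run p v s n v' s') {Λ : Type} (m : Λ → MStmt Λ)
    (emb : Lab p → Λ) (exit : Λ) (hm : ∀ l, m (emb l) = code p emb exit l) :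
    ∃ t ≤ n, (flip bind (TM2.step m))^[t] (some ⟨some (emb (entry p)), v, s⟩) =
      some ⟨some exit, v', s'⟩ := by
  have one : ∀ (l : Λ) v s, (flip bind (TM2.step m))^[1] (some ⟨some l, v, s⟩) =
      some (TM2.stepAux (m l) v s) := fun _ _ _ => rfl
  induction h generalizing Λ with
  | skip hn => exact ⟨1, hn, by rw [one, hm]; rfl⟩
  | push hn => exact ⟨1, hn, by rw [one, hm]; rfl⟩
  | pop hn => exact ⟨1, hn, by rw [one, hm]; rfl⟩
  | @seq p q _ _ _ _ _ _ _ _ _ _ _ hn ih₁ ih₂ =>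
    obtain ⟨t₁, ht₁, e₁⟩ := ih₁ m (fun l => emb (Sum.inl l)) (emb (Sum.inr (entry q)))
      (fun l => hm _) one
    obtain ⟨t₂, ht₂, e₂⟩ := ih₂ m (fun l => emb (Sum.inr l)) exit (fun l => hm _) one
    refine ⟨t₂ + t₁, by omega, ?_⟩
    rw [Function.iterate_add_apply]
    exact (congrArg _ e₁).trans e₂
  | @ite_true c p q v s _ _ _ _ hc _ hn ih =>
    obtain ⟨t, ht, e⟩ := ih m (fun l => emb (some (Sum.inl l))) exit (fun l => hm _) one
    refine ⟨t + 1, by omega, ?_⟩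
    rw [Function.iterate_add_apply, one, hm]
    simpa [code, entry, hc] using e
  | @ite_false c p q v s _ _ _ _ hc _ hn ih =>
    obtain ⟨t, ht, e⟩ := ih m (fun l => emb (some (Sum.inr l))) exit (fun l => hm _) one
    refine ⟨t + 1, by omega, ?_⟩
    rw [Function.iterate_add_apply, one, hm]
    simpa [code, entry, hc] using e
  | while_false hc hn =>
    refine ⟨1, hn, ?_⟩
    rw [one, hm]
    simp [code, entry, hc]
  | @while_true c p v s _ _ _ _ _ _ _ hc _ _ hn ih₁ ih₂ =>
    obtain ⟨t₁, ht₁, e₁⟩ := ih₁ m (fun l => emb (some l)) (emb none) (fun l => hm _) one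
    obtain ⟨t₂, ht₂, e₂⟩ := ih₂ m emb exit hm one
    refine ⟨t₂ + (t₁ + 1), by omega, ?_⟩
    rw [Function.iterate_add_apply, Function.iterate_add_apply, one, hm]
    have : TM2.stepAux (code (Prog.while c p) emb exit (entry (Prog.while c p))) v s =
        ⟨some (emb (some (entry p))), v, s⟩ := by simp [code, entry, hc]
    rw [this]
    exact (congrArg _ e₁).trans e₂

/-- The machine running a program on the stack `io`. -/
noncomputable def machine (p : Prog) : FinTM2 where
  K := Stk
  k₀ := .io
  k₁ := .io
  Γ _ := Γ'
  Λ := Option (Lab p)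
  main := some (entry p)
  σ := Option Γ'
  initialState := none
  Γk₀Fin := inferInstanceAs (Fintype Γ')
  m l := match l with
    | none => .halt
    | some l => code p some none l

/-- The stacks with given contents. -/
def mk (m x y c io : List Γ') : Stk → List Γ'
  | .main => m
  | .x => x
  | .y => y
  | .cnt => c
  | .io => io

/-- A program that rewrites the stack `io` within polynomially many steps gives a machine that
computes in polynomial time. -/
theorem computable_of_run {α β : Type} (ea : α → List Γ') (eb : β → List Γ') (f : α → β)
    (p : Prog) (P : Polynomial ℕ)
    (h : ∀ a, Run p none (mk [] [] [] [] (ea a)) (P.eval (ea a).length) none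
      (mk [] [] [] [] (eb (f a)))) :
    Nonempty (TM2ComputableInPolyTime ea eb f) := by
  refine ⟨{ tm := machine p, inputAlphabet := Equiv.refl Γ', outputAlphabet := Equiv.refl Γ',
            -- The extra step executes the halting statement at the exit label.
            time := P + 1, outputsFun := fun a => Classical.choice ?_ }⟩
  obtain ⟨t, ht, e⟩ := (h a).reaches (machine p).m some none (fun l => rfl)
  have h₀ : initList (machine p) (List.map (Equiv.refl Γ').invFun (ea a)) =
      ⟨some (some (entry p)), none, mk [] [] [] [] (ea a)⟩ := by
    simp only [initList]
    congr 1
    funext k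
    cases k
    case io =>
      simp [machine, mk]
      rfl
    all_goals simp [machine, mk]
  have h₁ : haltList (machine p) (List.map (Equiv.refl Γ').invFun (eb (f a))) =
      ⟨none, none, mk [] [] [] [] (eb (f a))⟩ := by
    simp only [haltList]
    congr 1
    funext k
    cases k
    case io =>
      simp [machine, mk]
      rfl
    all_goals simp [machine, mk]
  refine ⟨⟨⟨t + 1, ?_⟩, ?_⟩⟩
  · rw [h₀, Option.map_some, h₁, add_comm, Function.iterate_add_apply]
    exact (congrArg _ e).trans rfl
  · simpa using ht

end Prog

/-! ### Binary trees on the main stack -/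

/-- Binary trees, the universal data type. -/
inductive BTree
  | leaf
  | node (l r : BTree)

/-- The self-delimiting string of a tree. -/
def BTree.ser : BTree → List Γ'
  | leaf => [Γ'.ket]
  | node l r => Γ'.bra :: (l.ser ++ r.ser)

namespace Prog

open Function (update)

section Updates

variable (m x y c io l : List Γ')

@[simp] theorem update_main : update (mk m x y c io) .main l = mk l x y c io := by
  funext k; cases k <;> rfl
@[simp] theorem update_x : update (mk m x y c io) .x l = mk m l y c io := by
  funext k; cases k <;> rfl
@[simp] theorem update_y : update (mk m x y c io) .y l = mk m x l c io := by
  funext k; cases k <;> rfl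
@[simp] theorem update_cnt : update (mk m x y c io) .cnt l = mk m x y l io := by
  funext k; cases k <;> rfl
@[simp] theorem update_io : update (mk m x y c io) .io l = mk m x y c l := by
  funext k; cases k <;> rfl

end Updates

section Basic

variable {m x y c io : List Γ'} {v : Option Γ'}

theorem run_pop_main : Run (pop .main) v (mk m x y c io) 1 m.head? (mk m.tail x y c io) := by
  simpa [mk] using Run.pop (k := .main) (v := v) (s := mk m x y c io) le_rfl
theorem run_pop_x : Run (pop .x) v (mk m x y c io) 1 x.head? (mk m x.tail y c io) := by
  simpa [mk] using Run.pop (k := .x) (v := v) (s := mk m x y c io) le_rfl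
theorem run_pop_y : Run (pop .y) v (mk m x y c io) 1 y.head? (mk m x y.tail c io) := by
  simpa [mk] using Run.pop (k := .y) (v := v) (s := mk m x y c io) le_rfl
theorem run_pop_cnt : Run (pop .cnt) v (mk m x y c io) 1 c.head? (mk m x y c.tail io) := by
  simpa [mk] using Run.pop (k := .cnt) (v := v) (s := mk m x y c io) le_rfl
theorem run_pop_io : Run (pop .io) v (mk m x y c io) 1 io.head? (mk m x y c io.tail) := by
  simpa [mk] using Run.pop (k := .io) (v := v) (s := mk m x y c io) le_rfl

variable {f : Option Γ' → Γ'}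

theorem run_push_main : Run (push .main f) v (mk m x y c io) 1 v (mk (f v :: m) x y c io) := by
  simpa [mk] using Run.push (k := .main) (f := f) (v := v) (s := mk m x y c io) le_rfl
theorem run_push_x : Run (push .x f) v (mk m x y c io) 1 v (mk m (f v :: x) y c io) := by
  simpa [mk] using Run.push (k := .x) (f := f) (v := v) (s := mk m x y c io) le_rfl
theorem run_push_y : Run (push .y f) v (mk m x y c io) 1 v (mk m x (f v :: y) c io) := by
  simpa [mk] using Run.push (k := .y) (f := f) (v := v) (s := mk m x y c io) le_rfl
theorem run_push_cnt : Run (push .cnt f) v (mk m x y c io) 1 v (mk m x y (f v :: c) io) := by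
  simpa [mk] using Run.push (k := .cnt) (f := f) (v := v) (s := mk m x y c io) le_rfl
theorem run_push_io : Run (push .io f) v (mk m x y c io) 1 v (mk m x y c (f v :: io)) := by
  simpa [mk] using Run.push (k := .io) (f := f) (v := v) (s := mk m x y c io) le_rfl

end Basic

/-- The symbol in the register. -/
def reg (v : Option Γ') : Γ' := v.getD Γ'.blank

/-- The register holds the symbol that starts a node. -/
def isBra (v : Option Γ') : Bool := v == some Γ'.bra

/-- Pop a stack until it is empty, with a given action on each symbol. -/
def drain (k : Stk) (body : Prog) : Prog :=
  seq (pop k) (Prog.while Option.isSome (seq body (pop k)))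

/-- The family `st` describes a configuration by the symbols still to be popped and those already
treated, so that all transfers between stacks are instances. Each symbol costs `d` steps for the
body, one for the next pop and one for the guard. -/
theorem run_drain {k : Stk} {body : Prog} {d : ℕ} (st : List Γ' → List Γ' → Stk → List Γ')
    (hb : ∀ a l r, Run body (some a) (st l r) d (some a) (st l (a :: r)))
    (hp : ∀ v l r, Run (pop k) v (st l r) 1 l.head? (st l.tail r)) (v : Option Γ')
    (l r : List Γ') :
    Run (drain k body) v (st l r) ((d + 2) * l.length + 2) none (st [] (l.reverse ++ r)) := by
  have : ∀ l r : List Γ', Run (Prog.while Option.isSome (seq body (pop k))) l.head? (st l.tail r)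
      ((d + 2) * l.length + 1) none (st [] (l.reverse ++ r)) := by
    intro l
    induction l with
    | nil => exact fun r => .while_false rfl (by simp)
    | cons a l ih =>
      intro r
      simp only [List.reverse_cons, List.append_assoc, List.cons_append, List.nil_append,
        List.length_cons]
      exact .while_true rfl (.seq (hb a l r) (hp _ _ _) le_rfl) (ih _) (by grind)
  exact .seq (hp _ _ _) (this l r) (by omega)

/-- Move the symbols of `x` to the main stack. -/
def restore : Prog := drain .x (push .main reg)

theorem run_restore (v : Option Γ') (l m y c io : List Γ') :
    Run restore v (mk m l y c io) (3 * l.length + 2) none (mk (l.reverse ++ m) [] y c io) :=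
  run_drain (fun l r => mk r l y c io) (fun _ _ _ => run_push_main) (fun _ _ _ => run_pop_x)
    v l m

/-- Move the symbols of `x` to `y`. -/
def moveXY : Prog := drain .x (push .y reg)

theorem run_moveXY (v : Option Γ') (l m y c io : List Γ') :
    Run moveXY v (mk m l y c io) (3 * l.length + 2) none (mk m [] (l.reverse ++ y) c io) :=
  run_drain (fun l r => mk m l r c io) (fun _ _ _ => run_push_y) (fun _ _ _ => run_pop_x)
    v l y

/-- Move the symbols of `y` to `x`. -/
def moveYX : Prog := drain .y (push .x reg)

theorem run_moveYX (v : Option Γ') (l m x c io : List Γ') :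
    Run moveYX v (mk m x l c io) (3 * l.length + 2) none (mk m (l.reverse ++ x) [] c io) :=
  run_drain (fun l r => mk m r l c io) (fun _ _ _ => run_push_x) (fun _ _ _ => run_pop_y)
    v l x

/-- Move the symbols of `x` both to the main stack and to `y`. -/
def copyXY : Prog := drain .x (seq (push .main reg) (push .y reg))

theorem run_copyXY (v : Option Γ') (l m c io : List Γ') :
    Run copyXY v (mk m l [] c io) (4 * l.length + 2) none
      (mk (l.reverse ++ m) [] l.reverse c io) := by
  simpa [copyXY] using run_drain (fun l r => mk (r ++ m) l r c io)
    (fun a _ _ => .seq (n₁ := 1) (run_push_main (f := reg)) (run_push_y (f := reg)) le_rfl)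
    (fun _ _ _ => run_pop_x) v l []

/-- Empty the stack `x`. -/
def clearX : Prog := drain .x skip

theorem run_clearX (v : Option Γ') (l m y c io : List Γ') :
    Run clearX v (mk m l y c io) (3 * l.length + 2) none (mk m [] y c io) :=
  run_drain (fun l _ => mk m l y c io) (fun _ _ _ => .skip le_rfl) (fun _ _ _ => run_pop_x)
    v l []

/-- Move one symbol of the main stack to `x` and update the number of trees still to be read. -/
def takeBody : Prog :=
  seq (pop .main) (seq (push .x reg) (ite isBra (push .cnt fun _ => Γ'.bra) (pop .cnt)))

/-- Move the tree on top of the main stack to `x`. -/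
def take : Prog :=
  seq (push .cnt fun _ => Γ'.bra) (seq (pop .cnt) (Prog.while Option.isSome takeBody))

/-- The register together with the counter stack holds one symbol for each tree still to be read: a
node replaces one pending tree by two, and a leaf completes one. The statement is in continuation
form, from any run that goes on after `t`, so that the two subtrees of a node can be chained. -/
theorem run_take_aux (t : BTree) : ∀ (a : Γ') (m x y c io : List Γ') (n : ℕ) (v' : Option Γ')
    (s' : Stk → List Γ'),
    Run (Prog.while Option.isSome takeBody) c.head? (mk m (t.ser.reverse ++ x) y c.tail io)
      n v' s' →
    Run (Prog.while Option.isSome takeBody) (some a) (mk (t.ser ++ m) x y c io)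
      (n + 5 * t.ser.length) v' s' := by
  induction t with
  | leaf =>
    intro a m x y c io n v' s' h
    exact .while_true rfl (.seq run_pop_main (.seq run_push_x
      (.ite_false rfl run_pop_cnt le_rfl) le_rfl) le_rfl) h (by simp [BTree.ser]; omega)
  | node l r ihl ihr =>
    intro a m x y c io n v' s' h
    have h₂ := ihr Γ'.bra m (l.ser.reverse ++ Γ'.bra :: x) y c io n v' s'
      (by simpa [BTree.ser] using h)
    have h₁ := ihl Γ'.bra (r.ser ++ m) (Γ'.bra :: x) y (Γ'.bra :: c) io _ v' s' h₂
    refine .while_true rfl (.seq run_pop_main (.seq run_push_x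
      (.ite_true rfl run_push_cnt le_rfl) le_rfl) le_rfl)
      (n₂ := n + 5 * r.ser.length + 5 * l.ser.length) ?_ ?_
    · simpa [BTree.ser, reg] using h₁
    · simp [BTree.ser]; omega

theorem run_take (v : Option Γ') (t : BTree) (m x y io : List Γ') :
    Run take v (mk (t.ser ++ m) x y [] io) (5 * t.ser.length + 3) none
      (mk m (t.ser.reverse ++ x) y [] io) :=
  .seq run_push_cnt (.seq run_pop_cnt (run_take_aux t _ m x y [] io 1 none _
    (.while_false rfl le_rfl)) le_rfl) (by omega)

/-- Remove the tree on top of the main stack. -/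
def drop : Prog := seq take clearX

theorem run_drop (v : Option Γ') (t : BTree) (m io : List Γ') :
    Run drop v (mk (t.ser ++ m) [] [] [] io) (8 * t.ser.length + 5) none
      (mk m [] [] [] io) :=
  .seq (run_take v t m [] [] io) (run_clearX _ _ _ _ _ _) (by simp; omega)

/-- Duplicate the tree on top of the main stack. -/
def dup : Prog := seq take (seq copyXY (seq moveYX restore))

theorem run_dup (v : Option Γ') (t : BTree) (m io : List Γ') :
    Run dup v (mk (t.ser ++ m) [] [] [] io) (15 * t.ser.length + 9) none
      (mk (t.ser ++ (t.ser ++ m)) [] [] [] io) := by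
  refine .seq (run_take v t m [] [] io) (.seq (run_copyXY _ _ _ _ _)
    (.seq (run_moveYX _ _ _ _ _ _) (n₂ := 3 * t.ser.length + 2) ?_ le_rfl) le_rfl) ?_
  · simpa using run_restore none t.ser.reverse (t.ser ++ m) [] [] io
  · simp; omega

/-- Exchange the two trees on top of the main stack. -/
def swap : Prog := seq take (seq moveXY (seq take (seq moveYX restore)))

theorem run_swap (v : Option Γ') (t u : BTree) (m io : List Γ') :
    Run swap v (mk (t.ser ++ (u.ser ++ m)) [] [] [] io)
      (14 * t.ser.length + 8 * u.ser.length + 12) none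
      (mk (u.ser ++ (t.ser ++ m)) [] [] [] io) := by
  refine .seq (run_take v t _ [] [] io) (.seq (run_moveXY _ _ _ _ _ _)
    (.seq (run_take _ u m _ _ _) (.seq (run_moveYX _ _ _ _ _ _)
      (n₂ := 3 * t.ser.length + 3 * u.ser.length + 2) ?_ le_rfl) le_rfl) le_rfl) ?_
  · have := run_restore none (t.ser.reverse ++ u.ser.reverse) m [] [] io
    simpa [mul_add] using this
  · simp; omega

end Prog

/-! ### Polynomial-time functions on tree-encoded types -/

/-- Types encoded as binary trees. -/
class TreeEnc (α : Type) where
  /-- the tree of an element -/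
  enc : α → BTree

/-- The length of the string that encodes an element. -/
def esize {α : Type} [TreeEnc α] (a : α) : ℕ := (TreeEnc.enc a).ser.length

namespace TreeEnc

instance : TreeEnc Unit := ⟨fun _ => .leaf⟩

instance : TreeEnc Bool := ⟨fun b => if b then .node .leaf .leaf else .leaf⟩

instance {α β : Type} [TreeEnc α] [TreeEnc β] : TreeEnc (α × β) :=
  ⟨fun p => .node (enc p.1) (enc p.2)⟩

/-- The tree of a list. -/
def encList {α : Type} [TreeEnc α] : List α → BTree
  | [] => .leaf
  | a :: l => .node (enc a) (encList l)

instance {α : Type} [TreeEnc α] : TreeEnc (List α) := ⟨encList⟩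

/-- Natural numbers in unary, as lists of units. -/
instance : TreeEnc ℕ := ⟨fun n => enc (List.replicate n ())⟩

end TreeEnc

open TreeEnc

/-! ### Sizes of encodings. -/

section Size

variable {α β : Type} [TreeEnc α] [TreeEnc β]

@[simp] theorem esize_prod (p : α × β) : esize p = esize p.1 + esize p.2 + 1 := by
  simp [esize, enc, BTree.ser]

@[simp] theorem esize_nil : esize ([] : List α) = 1 := rfl

@[simp] theorem esize_cons (a : α) (l : List α) : esize (a :: l) = esize a + esize l + 1 := by
  simp [esize, enc, encList, BTree.ser]

@[simp] theorem esize_unit (u : Unit) : esize u = 1 := rfl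

theorem esize_pos (a : α) : 1 ≤ esize a := by
  unfold esize
  cases enc a <;> simp [BTree.ser]

theorem esize_list (l : List α) : esize l = (l.map fun a => esize a + 1).sum + 1 := by
  induction l with
  | nil => rfl
  | cons a l ih => simp [ih]; omega

@[simp] theorem esize_nat (n : ℕ) : esize n = 2 * n + 1 := by
  change esize (List.replicate n ()) = _
  simp [esize_list]; omega

theorem esize_bool_le (b : Bool) : esize b ≤ 3 := by
  cases b <;> simp [esize, enc, BTree.ser]

theorem esize_append (l₁ l₂ : List α) : esize (l₁ ++ l₂) + 1 = esize l₁ + esize l₂ := by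
  simp [esize_list]; omega

theorem length_lt_esize (l : List α) : l.length < esize l := by
  induction l with
  | nil => simp
  | cons a l ih => simp; omega

end Size

/-- Natural coefficients make bounds monotone, so a bound at an actual size may be replaced by its
value at an upper estimate. -/
theorem Polynomial.nat_eval_mono (P : Polynomial ℕ) : Monotone fun n => P.eval n := by
  intro a b h
  simp only [Polynomial.eval_eq_sum_range]
  gcongr

/-- Computable in polynomial time by a structured program that replaces the tree on top of the
main stack. -/
@[fun_prop]
def PolyTime {α β : Type} [TreeEnc α] [TreeEnc β] (f : α → β) : Prop :=
  ∃ (p : Prog) (P : Polynomial ℕ), ∀ a,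
    esize (f a) ≤ P.eval (esize a) ∧ ∀ m io v, ∃ v',
      p.Run v (Prog.mk ((enc a).ser ++ m) [] [] [] io) (P.eval (esize a)) v'
        (Prog.mk ((enc (f a)).ser ++ m) [] [] [] io)

namespace PolyTime

open Prog

variable {α β γ δ σ : Type} [TreeEnc α] [TreeEnc β] [TreeEnc γ] [TreeEnc δ] [TreeEnc σ]

/-- The size of the output is polynomially bounded. -/
theorem exists_size_le {f : α → β} (hf : PolyTime f) :
    ∃ P : Polynomial ℕ, ∀ a, esize (f a) ≤ P.eval (esize a) := by
  obtain ⟨_, P, h⟩ := hf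
  exact ⟨P, fun a => (h a).1⟩

/-- Functions that do not change the encoding. -/
theorem of_enc_eq {f : α → β} (h : ∀ a, enc (f a) = enc a) : PolyTime f := by
  refine ⟨.skip, Polynomial.X + 1, fun a => ⟨?_, fun m io v => ⟨v, ?_⟩⟩⟩
  · simp [esize, h]
  · rw [h]
    exact .skip (by simp)

theorem id : PolyTime fun a : α => a := of_enc_eq fun _ => rfl

theorem comp {g : β → γ} {f : α → β} (hg : PolyTime g) (hf : PolyTime f) :
    PolyTime fun a => g (f a) := by
  obtain ⟨p, P, hp⟩ := hf
  obtain ⟨q, Q, hq⟩ := hg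
  -- The second program runs on an input of size at most `P`; this is why `PolyTime` bounds sizes as
  -- well as steps.
  refine ⟨.seq p q, P + Q.comp P, fun a => ?_⟩
  have hm := Q.nat_eval_mono (hp a).1
  simp only [Polynomial.eval_add, Polynomial.eval_comp] at hm ⊢
  refine ⟨((hq _).1.trans hm).trans (Nat.le_add_left _ _), fun m io v => ?_⟩
  obtain ⟨v₁, h₁⟩ := (hp a).2 m io v
  obtain ⟨v₂, h₂⟩ := (hq (f a)).2 m io v₁
  exact ⟨v₂, .seq h₁ (h₂.mono hm) le_rfl⟩

/-- One copy of the argument becomes the second component, the trees are exchanged, and the other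
copy becomes the first. A leading `bra` then joins the two adjacent trees into a node. -/
theorem pair {f : α → β} {g : α → γ} (hf : PolyTime f) (hg : PolyTime g) :
    PolyTime fun a => (f a, g a) := by
  obtain ⟨p, P, hp⟩ := hf
  obtain ⟨q, Q, hq⟩ := hg
  refine ⟨.seq dup (.seq q (.seq swap (.seq p (.push .main fun _ => Γ'.bra)))),
    8 * Polynomial.X + 15 * Polynomial.X + 14 * Q + Q + P + 22, fun a => ⟨?_, fun m io v => ?_⟩⟩
  · have h₁ := (hp a).1
    have h₂ := (hq a).1
    simp
    omega
  · obtain ⟨v₁, h₁⟩ := (hq a).2 ((enc a).ser ++ m) io none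
    obtain ⟨v₂, h₂⟩ := (hp a).2 ((enc (g a)).ser ++ m) io none
    have h₃ := (hq a).1
    refine ⟨v₂, .seq (run_dup v (enc a) m io) (.seq h₁ (.seq (run_swap _ _ _ _ _)
      (.seq h₂ (n₂ := 1) ?_ le_rfl) le_rfl) le_rfl) ?_⟩
    · simpa [enc, BTree.ser] using run_push_main (f := fun _ => Γ'.bra) (v := v₂)
        (m := (enc (f a)).ser ++ ((enc (g a)).ser ++ m)) (x := []) (y := []) (c := []) (io := io)
    · simp [esize] at h₃ ⊢
      omega

theorem fst : PolyTime fun p : α × β => p.1 := by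
  refine ⟨.seq (.pop .main) (.seq swap drop), 22 * Polynomial.X + 18,
    fun p => ⟨by simp; omega, fun m io v => ⟨none, ?_⟩⟩⟩
  have h : (enc p).ser ++ m = Γ'.bra :: ((enc p.1).ser ++ ((enc p.2).ser ++ m)) := by
    simp [enc, BTree.ser]
  rw [h]
  exact .seq run_pop_main (.seq (run_swap _ _ _ _ _) (run_drop _ _ _ _) le_rfl)
    (by simp; simp [esize]; omega)

theorem snd : PolyTime fun p : α × β => p.2 := by
  refine ⟨.seq (.pop .main) drop, 8 * Polynomial.X + 6,
    fun p => ⟨by simp; omega, fun m io v => ⟨none, ?_⟩⟩⟩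
  have h : (enc p).ser ++ m = Γ'.bra :: ((enc p.1).ser ++ ((enc p.2).ser ++ m)) := by
    simp [enc, BTree.ser]
  rw [h]
  exact .seq run_pop_main (run_drop _ _ _ _) (by simp; simp [esize]; omega)

theorem unit : PolyTime fun _ : α => () := by
  refine ⟨.seq drop (.push .main fun _ => Γ'.ket), 8 * Polynomial.X + 6,
    fun p => ⟨by simp, fun m io v => ⟨none, ?_⟩⟩⟩
  exact .seq (run_drop _ _ _ _) run_push_main (by simp [esize])

/-- Distinction of cases on a list. -/
theorem list_casesOn {f : α → List β} {g : α → γ} {h : α × (β × List β) → γ}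
    (hf : PolyTime f) (hg : PolyTime g) (hh : PolyTime h) :
    PolyTime fun a => match f a with
      | [] => g a
      | b :: l => h (a, (b, l)) := by
  obtain ⟨p, P, hp⟩ := hf
  obtain ⟨q, Q, hq⟩ := hg
  obtain ⟨r, R, hr⟩ := hh
  -- The first symbol of a serialized list tells whether it is empty. A nonempty list has the same
  -- code as the pair of its head and tail, so pushing the symbol back yields the argument of `h`.
  refine ⟨.seq dup (.seq p (.seq (.pop .main) (.ite isBra
      (.seq (.push .main fun _ => Γ'.bra) (.seq swap (.seq (.push .main fun _ => Γ'.bra) r))) q))),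
    8 * Polynomial.X + 15 * Polynomial.X + 14 * P + P + Q + R.comp (Polynomial.X + P + 1) + 40,
    fun a => ?_⟩
  have hP := (hp a).1
  have hrun := (hp a).2
  beta_reduce
  generalize f a = l at hP hrun ⊢
  cases l with
  | nil =>
    have hQ := (hq a).1
    refine ⟨by simp; omega, fun m io v => ?_⟩
    obtain ⟨v₁, h₁⟩ := hrun ((enc a).ser ++ m) io none
    obtain ⟨v₂, h₂⟩ := (hq a).2 m io (some Γ'.ket)
    exact ⟨v₂, .seq (run_dup v (enc a) m io) (.seq h₁ (.seq run_pop_main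
      (.ite_false rfl h₂ le_rfl) le_rfl) le_rfl) (by simp [esize]; omega)⟩
  | cons b l =>
    have hR := (hr (a, (b, l))).1
    have hm : R.eval (esize (a, (b, l))) ≤ R.eval (esize a + P.eval (esize a) + 1) :=
      R.nat_eval_mono (by simpa using hP)
    refine ⟨by simp [Polynomial.eval_comp] at hR hm ⊢; omega, fun m io v => ?_⟩
    obtain ⟨v₁, h₁⟩ := hrun ((enc a).ser ++ m) io none
    obtain ⟨v₂, h₂⟩ := (hr (a, (b, l))).2 m io none
    have h₃ : Run r none (mk (Γ'.bra :: ((enc a).ser ++ ((enc (b, l)).ser ++ m))) [] [] [] io)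
        (R.eval (esize a + P.eval (esize a) + 1)) v₂
        (mk ((enc (h (a, (b, l)))).ser ++ m) [] [] [] io) := by
      refine Run.mono ?_ hm
      simpa [enc, BTree.ser] using h₂
    have h₄ := run_swap (some Γ'.bra) (enc (b, l)) (enc a) m io
    refine ⟨v₂, .seq (run_dup v (enc a) m io) (.seq h₁ (.seq run_pop_main (.ite_true rfl
      (.seq run_push_main (.seq (n₁ := 14 * (enc (b, l)).ser.length + 8 * (enc a).ser.length + 12)
        (v₁ := none) (s₁ := mk ((enc a).ser ++ ((enc (b, l)).ser ++ m)) [] [] [] io) ?_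
        (.seq run_push_main h₃ le_rfl) le_rfl) le_rfl) le_rfl) le_rfl) le_rfl) ?_⟩
    · simpa [enc, encList, BTree.ser] using h₄
    have : (enc (b, l)).ser.length = esize (b :: l) := rfl
    rw [this]
    have : (enc a).ser.length = esize a := rfl
    rw [this]
    simp [Polynomial.eval_comp] at hP ⊢
    omega

/-- Expose the first symbol of the first component of a pair. -/
def openPair : Prog := .seq (.pop .main) (.pop .main)

theorem run_openPair (l : α) (b : β) (m io : List Γ') (v : Option Γ') :
    Run openPair v (mk ((enc (l, b)).ser ++ m) [] [] [] io) 2 (enc l).ser.head?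
      (mk ((enc l).ser.tail ++ ((enc b).ser ++ m)) [] [] [] io) := by
  have h : (enc (l, b)).ser ++ m = Γ'.bra :: ((enc l).ser ++ ((enc b).ser ++ m)) := by
    simp [enc, BTree.ser]
  rw [h]
  generalize enc l = t
  cases t <;> exact .seq run_pop_main run_pop_main le_rfl

/-- Run a program on pairs as long as the first component is a nonempty list. -/
def loopProg (p : Prog) : Prog :=
  .seq openPair (.seq (.while isBra
    (.seq (.push .main fun _ => Γ'.bra) (.seq (.push .main fun _ => Γ'.bra) (.seq p openPair))))
    (.seq (.push .main fun _ => Γ'.ket) (.push .main fun _ => Γ'.bra)))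

/-- Each round starts with the outer `bra` and the first symbol of the list removed. Pushing `bra`
twice turns the exposed head and tail into the pair `((b, l), (a, s))`. Since `N` bounds all
intermediate sizes, every round fits into the same number of steps. -/
theorem run_loop {h : α × (σ × β) → σ} {p : Prog} {B : Polynomial ℕ} {N : ℕ} (a : α)
    (hp : ∀ (b : β) (l : List β) (s : σ) m io v, ∃ v', p.Run v
      (mk ((enc ((b, l), (a, s))).ser ++ m) [] [] [] io)
      (B.eval (esize ((b, l), (a, s)))) v'
      (mk ((enc (l, (a, h (a, (s, b))))).ser ++ m) [] [] [] io))
    (m io : List Γ') (l : List β) : ∀ s : σ,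
    (∀ l₁ l₂, l = l₁ ++ l₂ →
      esize (l₂, (a, l₁.foldl (fun s b => h (a, (s, b))) s)) ≤ N) →
    Run (.while isBra (.seq (.push .main fun _ => Γ'.bra) (.seq (.push .main fun _ => Γ'.bra)
        (.seq p openPair))))
      (enc l).ser.head? (mk ((enc l).ser.tail ++ ((enc (a, s)).ser ++ m)) [] [] [] io)
      (l.length * (B.eval N + 5) + 1) (some Γ'.ket)
      (mk ((enc (a, l.foldl (fun s b => h (a, (s, b))) s)).ser ++ m) [] [] [] io) := by
  induction l with
  | nil => exact fun s _ => .while_false rfl (by simp)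
  | cons b l ih =>
    intro s hN
    obtain ⟨v', h₁⟩ := hp b l s m io (some Γ'.bra)
    have h₀ : B.eval (esize ((b, l), (a, s))) ≤ B.eval N :=
      B.nat_eval_mono (by simpa using hN [] (b :: l) rfl)
    have h₂ := ih (h (a, (s, b))) fun l₁ l₂ e => hN (b :: l₁) l₂ (by simp [e])
    refine .while_true rfl (.seq run_push_main (.seq run_push_main (.seq (Run.mono ?_ h₀)
      (run_openPair l (a, h (a, (s, b))) m io v') le_rfl) le_rfl) le_rfl) h₂ ?_
    · simpa [enc, encList, BTree.ser] using h₁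
    · simp
      ring_nf
      omega

/-- Folding over a list, with intermediate results of polynomially bounded size. -/
theorem foldl_of_bound {f : α → List β} {g : α → σ} {h : α × (σ × β) → σ} (hf : PolyTime f)
    (hg : PolyTime g) (hh : PolyTime h) (Q : Polynomial ℕ)
    (hQ : ∀ a l₁ l₂, f a = l₁ ++ l₂ →
      esize (l₁.foldl (fun s b => h (a, (s, b))) (g a)) ≤ Q.eval (esize a)) :
    PolyTime fun a => (f a).foldl (fun s b => h (a, (s, b))) (g a) := by
  have hbody : PolyTime fun x : (β × List β) × (α × σ) =>
      (x.1.2, (x.2.1, h (x.2.1, (x.2.2, x.1.1)))) :=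
    (snd.comp fst).pair ((fst.comp snd).pair
      (hh.comp ((fst.comp snd).pair ((snd.comp snd).pair (fst.comp fst)))))
  obtain ⟨F, hF⟩ := hf.exists_size_le
  obtain ⟨p, P, hp⟩ := hf.pair (id.pair hg)
  obtain ⟨b, B, hb⟩ := hbody
  have hloop : ∃ (p : Prog) (P : Polynomial ℕ), ∀ a, ∀ m io v, ∃ v',
      p.Run v (mk ((enc a).ser ++ m) [] [] [] io) (P.eval (esize a)) v'
        (mk ((enc (([] : List β), (a, (f a).foldl (fun s b => h (a, (s, b))) (g a)))).ser ++ m)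
          [] [] [] io) := by
    -- Bounds for the remaining list, the state and the parameter, and two symbols for the two
    -- pairs.
    let N := F + Q + Polynomial.X + 2
    refine ⟨.seq p (loopProg b), P + N * (B.comp N + 5) + 10, fun a m io v => ?_⟩
    obtain ⟨v₁, h₁⟩ := (hp a).2 m io v
    have h₂ := run_loop (h := h) (N := N.eval (esize a)) a
      (fun b l s m io v => (hb ((b, l), (a, s))).2 m io v) m io (f a) (g a) fun l₁ l₂ e => by
        have h₃ := hQ a l₁ l₂ e
        have h₄ := hF a
        have h₅ := esize_append l₁ l₂
        have := esize_pos l₁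
        rw [e] at h₄
        simp [N]
        omega
    have hl : (f a).length ≤ N.eval (esize a) := by
      have := length_lt_esize (f a)
      have := hF a
      simp [N]
      omega
    have h₃ := h₂.mono (Nat.add_le_add_right
      (Nat.mul_le_mul_right (B.eval (N.eval (esize a)) + 5) hl) 1)
    refine ⟨some Γ'.ket, .seq h₁ (.seq (run_openPair (f a) (a, g a) m io v₁) (.seq h₃
        (.seq run_push_main run_push_main le_rfl) le_rfl) le_rfl) ?_⟩
    simp [Polynomial.eval_comp]
    omega
  obtain ⟨q, R, hq⟩ := hloop
  obtain ⟨r, S, hr⟩ := (snd.comp snd : PolyTime fun x : List β × (α × σ) => x.2.2)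
  refine ⟨.seq q r, R + S.comp (Polynomial.X + Q + 3) + Q, fun a => ⟨?_, fun m io v => ?_⟩⟩
  · have := hQ a (f a) [] (by simp)
    simp
    omega
  · obtain ⟨v₁, h₁⟩ := hq a m io v
    obtain ⟨v₂, h₂⟩ := (hr ([], (a, (f a).foldl (fun s b => h (a, (s, b))) (g a)))).2 m io v₁
    refine ⟨v₂, .seq h₁ h₂ ?_⟩
    have := hQ a (f a) [] (by simp)
    have : S.eval (esize (([] : List β), (a, (f a).foldl (fun s b => h (a, (s, b))) (g a)))) ≤
        S.eval (esize a + Q.eval (esize a) + 3) :=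
      S.nat_eval_mono (by simp; omega)
    simp [Polynomial.eval_comp] at this ⊢
    omega

end PolyTime

/-! ### Input and output -/

/-- Symbols of the encodings of automata: a comma is `(false, false)` and a bit `b` is
`(true, b)`. -/
abbrev Symb := Bool × Bool

/-- The symbol of a letter of the alphabet `Γ'`. -/
def Symb.ofΓ' : Γ' → Symb
  | Γ'.bit b => (true, b)
  | _ => (false, false)

/-- The letter of the alphabet `Γ'` for a symbol. -/
def Symb.toΓ' (s : Symb) : Γ' := if s.1 then Γ'.bit s.2 else Γ'.comma

open TreeEnc

namespace Prog

/-- Push a string on the main stack. -/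
def pushAll : List Γ' → Prog
  | [] => skip
  | a :: l => seq (pushAll l) (push .main fun _ => a)

theorem run_pushAll (l m x y c io : List Γ') (v : Option Γ') :
    Run (pushAll l) v (mk m x y c io) (l.length + 1) v (mk (l ++ m) x y c io) := by
  induction l with
  | nil => exact .skip le_rfl
  | cons a l ih => exact .seq ih run_push_main le_rfl

/-- The string of a nonempty list of symbols, without its tail. -/
def symString (s : Symb) : List Γ' := Γ'.bra :: (enc s).ser

/-- Push the symbol in the register on the list of symbols on the main stack. -/
def pushSym : Prog :=
  ite (fun v => v == some (Γ'.bit true)) (pushAll (symString (true, true)))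
    (ite (fun v => v == some (Γ'.bit false)) (pushAll (symString (true, false)))
      (pushAll (symString (false, false))))

theorem run_pushSym (a : Γ') (l m x y c io : List Γ') :
    Run pushSym (some a) (mk ((enc (l.map Symb.ofΓ')).ser ++ m) x y c io) 12 (some a)
      (mk ((enc ((a :: l).map Symb.ofΓ')).ser ++ m) x y c io) := by
  have h : (enc ((a :: l).map Symb.ofΓ')).ser ++ m =
      symString (Symb.ofΓ' a) ++ ((enc (l.map Symb.ofΓ')).ser ++ m) := by
    simp [enc, encList, BTree.ser, symString]
  rw [h]
  have key := fun s =>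
    run_pushAll (symString s) ((enc (l.map Symb.ofΓ')).ser ++ m) x y c io (some a)
  rcases a with _ | b | _ | _ | _
  case bit =>
    cases b
    · exact .ite_false rfl (.ite_true rfl (key _) le_rfl) (by decide)
    · exact .ite_true rfl (key _) (by decide)
  all_goals exact .ite_false rfl (.ite_false rfl (key _) le_rfl) (by decide)

/-- Read the input. -/
def readInput : Prog :=
  seq (drain .io (push .x reg)) (seq (push .main fun _ => Γ'.ket) (drain .x pushSym))

/-- Passing through `x` reverses the input, and building the list by prepending reverses it again.
-/
theorem run_readInput (l : List Γ') (v : Option Γ') :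
    Run readInput v (mk [] [] [] [] l) (17 * l.length + 5) none
      (mk (enc (l.map Symb.ofΓ')).ser [] [] [] []) := by
  have h₁ := run_drain (k := .io) (fun l r => mk [] r [] [] l) (fun _ _ _ => run_push_x (f := reg))
    (fun _ _ _ => run_pop_io) v l []
  have h₂ := run_drain (k := .x) (fun l r => mk ((enc (r.map Symb.ofΓ')).ser ++ []) l [] [] [])
    (fun _ _ _ => run_pushSym _ _ _ _ _ _ _) (fun _ _ _ => run_pop_x) none l.reverse []
  simp only [List.append_nil, List.reverse_reverse] at h₁ h₂
  exact .seq h₁ (.seq run_push_main h₂ le_rfl) (by simp; omega)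

/-- Move one symbol from the main stack to the output. -/
def writeSym : Prog :=
  seq (pop .main) (seq (pop .main) (seq
    (ite isBra
      (seq (pop .main) (seq (pop .main) (seq (pop .main) (ite isBra
        (seq (pop .main) (seq (pop .main) (push .io fun _ => Γ'.bit true)))
        (push .io fun _ => Γ'.bit false)))))
      (seq (pop .main) (seq (ite isBra (seq (pop .main) (pop .main)) skip)
        (push .io fun _ => Γ'.comma))))
    (pop .main)))

theorem run_writeSym (s : Symb) (m io : List Γ') (v : Option Γ') :
    Run writeSym v (mk ((enc s).ser ++ m) [] [] [] io) 12 m.head?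
      (mk m.tail [] [] [] (s.toΓ' :: io)) := by
  obtain ⟨_ | _, _ | _⟩ := s
  · exact .seq run_pop_main (.seq run_pop_main (.seq (.ite_false rfl (.seq run_pop_main
      (.seq (.ite_false rfl (.skip le_rfl) le_rfl) run_push_io le_rfl) le_rfl) le_rfl)
      run_pop_main le_rfl) le_rfl) (by omega)
  · exact .seq run_pop_main (.seq run_pop_main (.seq (.ite_false rfl (.seq run_pop_main
      (.seq (.ite_true rfl (.seq run_pop_main run_pop_main le_rfl) le_rfl) run_push_io le_rfl)
      le_rfl) le_rfl) run_pop_main le_rfl) le_rfl) (by omega)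
  · exact .seq run_pop_main (.seq run_pop_main (.seq (.ite_true rfl (.seq run_pop_main
      (.seq run_pop_main (.seq run_pop_main (.ite_false rfl run_push_io le_rfl) le_rfl) le_rfl)
      le_rfl) le_rfl) run_pop_main le_rfl) le_rfl) (by omega)
  · exact .seq run_pop_main (.seq run_pop_main (.seq (.ite_true rfl (.seq run_pop_main
      (.seq run_pop_main (.seq run_pop_main (.ite_true rfl (.seq run_pop_main (.seq run_pop_main
      run_push_io le_rfl) le_rfl) le_rfl) le_rfl) le_rfl) le_rfl) le_rfl) run_pop_main le_rfl)
      le_rfl) (by omega)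

/-- Move a list of symbols from the main stack to the output, in reverse order. -/
def writeOutput : Prog :=
  seq (pop .main) (seq (.while isBra writeSym) (pop .main))

theorem run_writeOutput (l : List Symb) (v : Option Γ') :
    Run writeOutput v (mk (enc l).ser [] [] [] []) (13 * l.length + 3) none
      (mk [] [] [] [] (l.map Symb.toΓ').reverse) := by
  have : ∀ (l : List Symb) (io : List Γ'), Run (.while isBra writeSym) (enc l).ser.head?
      (mk (enc l).ser.tail [] [] [] io) (13 * l.length + 1) (some Γ'.ket)
      (mk [] [] [] [] ((l.map Symb.toΓ').reverse ++ io)) := by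
    intro l
    induction l with
    | nil => exact fun io => .while_false rfl le_rfl
    | cons s l ih =>
      intro io
      simp only [List.map_cons, List.reverse_cons, List.append_assoc, List.cons_append,
        List.nil_append]
      exact .while_true rfl (run_writeSym s (enc l).ser io _) (ih _) (by simp; omega)
  have h := this l []
  rw [List.append_nil] at h
  exact .seq run_pop_main (.seq h run_pop_main le_rfl) (by omega)

end Prog

theorem esize_symb_le (l : List Symb) : esize l ≤ 8 * l.length + 1 := by
  induction l with
  | nil => simp
  | cons s l ih =>
    have h₁ := esize_bool_le s.1
    have h₂ := esize_bool_le s.2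
    simp
    omega

/-- Polynomial-time functions on lists of symbols are computed by Turing machines in polynomial
time. -/
theorem PolyTime.computable {α β : Type} {ea : α → List Γ'} {eb : β → List Γ'} {f : α → β}
    {F : List Symb → List Symb} (hF : PolyTime F)
    (h : ∀ a, (F ((ea a).map Symb.ofΓ')).map Symb.toΓ' = (eb (f a)).reverse) :
    Nonempty (TM2ComputableInPolyTime ea eb f) := by
  obtain ⟨p, P, hp⟩ := hF
  refine Prog.computable_of_run ea eb f
    (.seq Prog.readInput (.seq p Prog.writeOutput))
    (17 * Polynomial.X + P.comp (8 * Polynomial.X + 1) + 13 * P.comp (8 * Polynomial.X + 1) + 8)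
    fun a => ?_
  have h₁ := Prog.run_readInput (ea a) none
  obtain ⟨hs, hr⟩ := hp ((ea a).map Symb.ofΓ')
  obtain ⟨v, h₂⟩ := hr [] [] none
  have h₃ := Prog.run_writeOutput (F ((ea a).map Symb.ofΓ')) v
  have hm := P.nat_eval_mono (esize_symb_le ((ea a).map Symb.ofΓ'))
  have hl := length_lt_esize (F ((ea a).map Symb.ofΓ'))
  simp only [List.append_nil] at h₂
  rw [h, List.reverse_reverse] at h₃
  refine .seq h₁ (.seq h₂ h₃ le_rfl) ?_
  simp [Polynomial.eval_comp] at *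
  omega

/-! ### A library of polynomial-time functions -/

open TreeEnc

namespace PolyTime

variable {α β γ δ σ : Type} [TreeEnc α] [TreeEnc β] [TreeEnc γ] [TreeEnc δ] [TreeEnc σ]

attribute [fun_prop] PolyTime.id PolyTime.comp

/-- Trees become data themselves, so that constant functions are obtained by induction on the tree
of the constant. -/
instance : TreeEnc BTree := ⟨fun t => t⟩

theorem const_tree (t : BTree) : PolyTime fun _ : α => t := by
  induction t with
  | leaf => exact (of_enc_eq fun _ => rfl : PolyTime fun _ : Unit => BTree.leaf).comp unit
  | node l r hl hr =>
    exact (of_enc_eq fun _ => rfl : PolyTime fun p : BTree × BTree => BTree.node p.1 p.2).comp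
      (hl.pair hr)

@[fun_prop]
theorem const (b : β) : PolyTime fun _ : α => b := by
  obtain ⟨p, P, h⟩ := const_tree (α := α) (enc b)
  exact ⟨p, P, h⟩

@[fun_prop]
theorem prod_mk {f : α → β} {g : α → γ} (hf : PolyTime f) (hg : PolyTime g) :
    PolyTime fun a => (f a, g a) := hf.pair hg

@[fun_prop]
theorem prod_fst {f : α → β × γ} (hf : PolyTime f) : PolyTime fun a => (f a).1 := fst.comp hf

@[fun_prop]
theorem prod_snd {f : α → β × γ} (hf : PolyTime f) : PolyTime fun a => (f a).2 := snd.comp hf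

/-- Functions with the same encodings of the results. -/
theorem of_enc {f : α → β} {g : α → γ} (hf : PolyTime f) (h : ∀ a, enc (g a) = enc (f a)) :
    PolyTime g := by
  obtain ⟨p, P, hp⟩ := hf
  refine ⟨p, P, fun a => ?_⟩
  have := hp a
  simp only [esize] at *
  rw [h]
  exact this

@[fun_prop]
theorem list_cons {f : α → β} {g : α → List β} (hf : PolyTime f) (hg : PolyTime g) :
    PolyTime fun a => f a :: g a :=
  (hf.pair hg).of_enc fun _ => rfl

@[fun_prop]
theorem list_tail {f : α → List β} (hf : PolyTime f) : PolyTime fun a => (f a).tail := by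
  refine (list_casesOn hf (const []) (snd.comp snd)).of_enc fun a => ?_
  cases f a <;> rfl

@[fun_prop]
theorem list_headD {f : α → List β} {g : α → β} (hf : PolyTime f) (hg : PolyTime g) :
    PolyTime fun a => (f a).headD (g a) := by
  refine (list_casesOn hf hg (fst.comp snd)).of_enc fun a => ?_
  cases f a <;> rfl

-- A Boolean has the code of a list of units, empty or of length one, which reduces the conditional
-- to case distinction on lists.
@[fun_prop]
theorem ite {c : α → Bool} {f g : α → β} (hc : PolyTime c) (hf : PolyTime f) (hg : PolyTime g) :
    PolyTime fun a => if c a then f a else g a := by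
  have h : PolyTime fun a => if c a then [()] else [] :=
    hc.of_enc fun a => by cases c a <;> rfl
  refine (list_casesOn h hg (hf.comp fst)).of_enc fun a => ?_
  cases c a <;> rfl

@[fun_prop]
theorem bool_and {f g : α → Bool} (hf : PolyTime f) (hg : PolyTime g) :
    PolyTime fun a => f a && g a := by
  refine (hf.ite hg (const false)).of_enc fun a => ?_
  cases f a <;> rfl

@[fun_prop]
theorem bool_or {f g : α → Bool} (hf : PolyTime f) (hg : PolyTime g) :
    PolyTime fun a => f a || g a := by
  refine (hf.ite (const true) hg).of_enc fun a => ?_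
  cases f a <;> rfl

@[fun_prop]
theorem bool_xor {f g : α → Bool} (hf : PolyTime f) (hg : PolyTime g) :
    PolyTime fun a => f a ^^ g a := by
  refine (hf.ite (hg.ite (const false) (const true)) hg).of_enc fun a => ?_
  cases f a <;> cases g a <;> rfl

@[fun_prop]
theorem bool_not {f : α → Bool} (hf : PolyTime f) : PolyTime fun a => !f a := by
  refine (hf.ite (const false) (const true)).of_enc fun a => ?_
  cases f a <;> rfl

/-- Folding over a list, where a measure of the state grows by a bounded amount at each step. -/
theorem foldl_of_measure {f : α → List β} {g : α → σ} {h : α → σ → β → σ} (hf : PolyTime f)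
    (hg : PolyTime g) (hh : PolyTime fun p : α × (σ × β) => h p.1 p.2.1 p.2.2) (μ : σ → ℕ)
    (E : Polynomial ℕ) (hE : ∀ s, esize s ≤ E.eval (μ s)) (hμ : ∀ s, μ s ≤ esize s)
    (R : Polynomial ℕ) (hR : ∀ a s b, μ (h a s b) ≤ μ s + R.eval (esize a + esize b)) :
    PolyTime fun a => (f a).foldl (fun s b => h a s b) (g a) := by
  obtain ⟨F, hF⟩ := hf.exists_size_le
  obtain ⟨G, hG⟩ := hg.exists_size_le
  -- The measure is at most `G` initially, and each of at most `F` rounds adds at most `R` at the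
  -- size of the parameter plus that of one list element.
  refine foldl_of_bound hf hg hh (E.comp (G + F * R.comp (Polynomial.X + F))) fun a l₁ l₂ e => ?_
  have key : ∀ (l : List β) (s : σ), esize l ≤ F.eval (esize a) →
      μ (l.foldl (fun s b => h a s b) s) ≤
        μ s + l.length * R.eval (esize a + F.eval (esize a)) := by
    intro l
    induction l with
    | nil => simp
    | cons b l ih =>
      intro s hl
      simp only [esize_cons] at hl
      have h₁ := ih (h a s b) (by omega)
      have h₂ := hR a s b
      have h₃ : R.eval (esize a + esize b) ≤ R.eval (esize a + F.eval (esize a)) :=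
        R.nat_eval_mono (by omega)
      simp only [List.foldl_cons, List.length_cons, add_mul, one_mul]
      omega
  have hl : esize l₁ ≤ F.eval (esize a) := by
    have h₁ := hF a
    have h₂ := esize_append l₁ l₂
    have := esize_pos l₂
    rw [← e] at h₂
    omega
  refine (hE _).trans ?_
  rw [Polynomial.eval_comp]
  refine E.nat_eval_mono ((key l₁ (g a) hl).trans ?_)
  simp only [Polynomial.eval_add, Polynomial.eval_mul, Polynomial.eval_comp, Polynomial.eval_X]
  have h₁ := length_lt_esize l₁
  exact Nat.add_le_add ((hμ _).trans (hG a)) (Nat.mul_le_mul_right _ (by omega))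

/-- Folding over a list, where the size of the state grows by a bounded amount at each step. -/
theorem foldl {f : α → List β} {g : α → σ} {h : α → σ → β → σ} (hf : PolyTime f)
    (hg : PolyTime g) (hh : PolyTime fun p : α × (σ × β) => h p.1 p.2.1 p.2.2)
    (R : Polynomial ℕ) (hR : ∀ a s b, esize (h a s b) ≤ esize s + R.eval (esize a + esize b)) :
    PolyTime fun a => (f a).foldl (fun s b => h a s b) (g a) :=
  foldl_of_measure hf hg hh esize .X (by simp) (by simp) R hR

@[fun_prop]
theorem list_reverse {f : α → List β} (hf : PolyTime f) : PolyTime fun a => (f a).reverse := by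
  have := foldl (h := fun _ s b => b :: s) hf (const []) (by fun_prop) (Polynomial.X + 1)
    (fun a s b => by simp; omega)
  simpa [List.foldl_flip_cons_eq_append] using this

@[fun_prop]
theorem list_append {f g : α → List β} (hf : PolyTime f) (hg : PolyTime g) :
    PolyTime fun a => f a ++ g a := by
  have := foldl (h := fun _ s b => b :: s) hf.list_reverse hg (by fun_prop) (Polynomial.X + 1)
    (fun a s b => by simp; omega)
  simpa [List.foldl_flip_cons_eq_append] using this

@[fun_prop]
theorem list_flatMap {f : α → List β} {g : α → β → List γ} (hf : PolyTime f)
    (hg : PolyTime fun p : α × β => g p.1 p.2) : PolyTime fun a => (f a).flatMap (g a) := by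
  obtain ⟨G, hG⟩ := hg.exists_size_le
  have := foldl (h := fun a s b => s ++ g a b) hf (const [])
    (by fun_prop) (G.comp (Polynomial.X + 1)) (fun a s b => by
      have h₁ := hG (a, b)
      have h₂ := esize_append s (g a b)
      simp [Polynomial.eval_comp] at h₁ ⊢
      omega)
  simpa [List.flatMap_eq_foldl] using this

@[fun_prop]
theorem list_map {f : α → List β} {g : α → β → γ} (hf : PolyTime f)
    (hg : PolyTime fun p : α × β => g p.1 p.2) : PolyTime fun a => (f a).map (g a) := by
  have := hf.list_flatMap (g := fun a b => [g a b]) (by fun_prop)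
  simpa [← List.map_eq_flatMap] using this

@[fun_prop]
theorem list_filter {f : α → List β} {g : α → β → Bool} (hf : PolyTime f)
    (hg : PolyTime fun p : α × β => g p.1 p.2) : PolyTime fun a => (f a).filter (g a) := by
  have := hf.list_flatMap (g := fun a b => if g a b then [b] else []) (by fun_prop)
  have e : ∀ (l : List β) a, l.flatMap (fun b => if g a b then [b] else []) = l.filter (g a) := by
    intro l a
    induction l with
    | nil => rfl
    | cons b l ih => cases h : g a b <;> simp [h, ih]
  simpa [e] using this

/-! #### Natural numbers -/

@[fun_prop]
theorem list_length {f : α → List β} (hf : PolyTime f) : PolyTime fun a => (f a).length := by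
  have := hf.list_map (g := fun _ _ => ()) (by fun_prop)
  refine this.of_enc fun a => ?_
  simp [enc]

@[fun_prop]
theorem replicate {f : α → ℕ} {g : α → β} (hf : PolyTime f) (hg : PolyTime g) :
    PolyTime fun a => List.replicate (f a) (g a) := by
  have h : PolyTime fun a => List.replicate (f a) () := hf.of_enc fun _ => rfl
  simpa using h.list_map (g := fun a _ => g a) (by fun_prop)

@[fun_prop]
theorem nat_add {f g : α → ℕ} (hf : PolyTime f) (hg : PolyTime g) :
    PolyTime fun a => f a + g a := by
  simpa using ((hf.replicate (const ())).list_append (hg.replicate (const ()))).list_length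

@[fun_prop]
theorem nat_mul {f g : α → ℕ} (hf : PolyTime f) (hg : PolyTime g) :
    PolyTime fun a => f a * g a := by
  simpa using ((hf.replicate (const ())).list_flatMap (g := fun a _ => List.replicate (g a) ())
    (by fun_prop)).list_length

@[fun_prop]
theorem drop {f : α → ℕ} {g : α → List β} (hf : PolyTime f) (hg : PolyTime g) :
    PolyTime fun a => (g a).drop (f a) := by
  have := foldl (h := fun _ (s : List β) (_ : Unit) => s.tail) (hf.replicate (const ())) hg
    (by fun_prop) 0 (fun a s b => by cases s <;> simp; omega)
  have e : ∀ (n : ℕ) (l : List β),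
      (List.replicate n ()).foldl (fun s _ => s.tail) l = l.drop n := by
    intro n
    induction n with
    | zero => simp
    | succ n ih => intro l; simp [List.replicate_succ, ih]
  simpa [e] using this

@[fun_prop]
theorem getD {f : α → ℕ} {g : α → List β} {h : α → β} (hf : PolyTime f) (hg : PolyTime g)
    (hh : PolyTime h) : PolyTime fun a => (g a).getD (f a) (h a) := by
  have := (hf.drop hg).list_headD hh
  simpa [List.headD_eq_head?_getD, List.head?_drop, List.getD_eq_getElem?_getD] using this

@[fun_prop]
theorem nat_sub {f g : α → ℕ} (hf : PolyTime f) (hg : PolyTime g) :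
    PolyTime fun a => f a - g a := by
  simpa using (hg.drop (hf.replicate (const ()))).list_length

@[fun_prop]
theorem nat_max {f g : α → ℕ} (hf : PolyTime f) (hg : PolyTime g) :
    PolyTime fun a => max (f a) (g a) := by
  have : PolyTime fun a => f a + (g a - f a) := by fun_prop
  refine this.of_enc fun a => congrArg _ (by omega)

@[fun_prop]
theorem list_isEmpty {f : α → List β} (hf : PolyTime f) : PolyTime fun a => (f a).isEmpty := by
  refine (list_casesOn hf (const true) (const false)).of_enc fun a => ?_
  cases f a <;> rfl

@[fun_prop]
theorem nat_ble {f g : α → ℕ} (hf : PolyTime f) (hg : PolyTime g) :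
    PolyTime fun a => (f a).ble (g a) := by
  have : PolyTime fun a => (List.replicate (f a - g a) ()).isEmpty := by fun_prop
  refine this.of_enc fun a => congrArg _ ?_
  rw [Bool.eq_iff_iff]
  simp [Nat.sub_eq_zero_iff_le]

@[fun_prop]
theorem nat_beq {f g : α → ℕ} (hf : PolyTime f) (hg : PolyTime g) :
    PolyTime fun a => f a == g a := by
  have : PolyTime fun a => (f a).ble (g a) && (g a).ble (f a) := by fun_prop
  refine this.of_enc fun a => congrArg _ ?_
  rw [Bool.eq_iff_iff]
  simp only [beq_iff_eq, Bool.and_eq_true, Nat.ble_eq]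
  omega

-- The list grows by appending its own length. The increment depends on the state, so the total size
-- is bounded directly through `foldl_of_bound`.
@[fun_prop]
theorem list_range {f : α → ℕ} (hf : PolyTime f) : PolyTime fun a => List.range (f a) := by
  have e : ∀ n, (List.replicate n ()).foldl (fun (s : List ℕ) (_ : Unit) => s ++ [s.length]) [] =
      List.range n := by
    intro n
    induction n with
    | zero => rfl
    | succ n ih => simp [List.replicate_succ', ih, List.range_succ]
  have hs : ∀ n, esize (List.range n) ≤ n * (2 * n + 2) + 1 := by
    intro n
    rw [esize_list]
    have := List.sum_le_card_nsmul ((List.range n).map fun a => esize a + 1) (2 * n + 2)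
      (by simp; omega)
    simpa using this
  have hu := hf.replicate (const ())
  obtain ⟨F, hF⟩ := hu.exists_size_le
  have := foldl_of_bound (h := fun x : α × (List ℕ × Unit) => x.2.1 ++ [x.2.1.length])
    hu (const []) (by fun_prop) (F * (2 * F + 2) + 1) fun a l₁ l₂ h => by
      have h₁ := congrArg List.length h
      have h₂ := length_lt_esize (List.replicate (f a) ())
      have h₃ := hF a
      have h₄ : l₁ = List.replicate l₁.length () := List.eq_replicate_of_mem (by simp)
      rw [h₄, e]
      refine (hs _).trans ?_
      simp only [List.length_replicate, List.length_append] at h₁ h₂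
      have : l₁.length ≤ F.eval (esize a) := by omega
      simp only [Polynomial.eval_add, Polynomial.eval_mul, Polynomial.eval_ofNat,
        Polynomial.eval_one]
      gcongr
  simpa [e] using this

@[fun_prop]
theorem foldl_max {f : α → List ℕ} (hf : PolyTime f) : PolyTime fun a => (f a).foldl max 0 :=
  foldl (h := fun _ s b => max s b) hf (const 0) (by fun_prop) Polynomial.X
    (fun a s b => by simp; omega)

end PolyTime

/-! ### Binary arithmetic -/

/-- The value of a binary number, least significant bit first. -/
def bval : List Bool → ℕ
  | [] => 0
  | b :: l => b.toNat + 2 * bval l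

theorem bval_append (l l' : List Bool) : bval (l ++ l') = bval l + 2 ^ l.length * bval l' := by
  induction l with
  | nil => simp [bval]
  | cons b l ih => simp [bval, ih]; ring

theorem bval_eq_headD_tail (l : List Bool) :
    bval l = (l.headD false).toNat + 2 * bval l.tail := by
  cases l <;> simp [bval]

theorem bval_encodeNat (n : ℕ) : bval (encodeNat n) = n := by
  have h : ∀ p : PosNum, bval (encodePosNum p) = (p : ℕ) := by
    intro p
    induction p with
    | one => rfl
    | bit0 p ih => simp [encodePosNum, bval, ih]; omega
    | bit1 p ih => simp [encodePosNum, bval, ih]; omega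
  have h' : ∀ m : Num, bval (encodeNum m) = (m : ℕ) := by
    intro m
    cases m with
    | zero => rfl
    | pos p => exact h p
  rw [encodeNat, h']
  simp

/-- One step of the addition of binary numbers: the state holds the remaining digits of the
summands, the carry and the digits of the sum, in reverse order. -/
def addStep (s : (List Bool × List Bool) × (Bool × List Bool)) :
    (List Bool × List Bool) × (Bool × List Bool) :=
  ((s.1.1.tail, s.1.2.tail),
    ((s.1.1.headD false && s.1.2.headD false) ||
      (s.2.1 && (s.1.1.headD false || s.1.2.headD false)),
    (s.1.1.headD false ^^ s.1.2.headD false ^^ s.2.1) :: s.2.2))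

/-- Addition of binary numbers. -/
def badd (x y : List Bool) : List Bool :=
  -- The list is only a clock, longer than either summand.
  ((x ++ y ++ [false]).foldl (fun s _ => addStep s) ((x, y), (false, []))).2.2.reverse

/-- Invariant of schoolbook addition: the digits written, plus the remaining sum and carry shifted
past them. The clock outlasts both summands so that its last round writes out the carry. -/
theorem bval_foldl_addStep (l : List Bool) : ∀ (x y : List Bool) (c : Bool) (o : List Bool),
    x.length < l.length → y.length < l.length →
    bval (l.foldl (fun s _ => addStep s) ((x, y), (c, o))).2.2.reverse =
      bval o.reverse + 2 ^ o.length * (bval x + bval y + c.toNat) := by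
  induction l with
  | nil => simp
  | cons b l ih =>
    intro x y c o hx hy
    simp only [List.length_cons] at hx hy
    rw [List.foldl_cons, addStep]
    dsimp only
    by_cases hl : l = []
    · subst hl
      obtain rfl : x = [] := List.length_eq_zero_iff.1 (by simpa using hx)
      obtain rfl : y = [] := List.length_eq_zero_iff.1 (by simpa using hy)
      cases c <;> simp [bval_append, bval]
    · have : 0 < l.length := List.length_pos_iff.2 hl
      rw [ih _ _ _ _ (by rw [List.length_tail]; omega) (by rw [List.length_tail]; omega),
        List.reverse_cons, bval_append,
        bval_eq_headD_tail x, bval_eq_headD_tail y]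
      simp only [List.length_reverse, List.length_cons, pow_succ]
      cases x.headD false <;> cases y.headD false <;> cases c <;> simp [bval] <;> ring

theorem bval_badd (x y : List Bool) : bval (badd x y) = bval x + bval y := by
  rw [badd, bval_foldl_addStep _ _ _ _ _ (by grind) (by grind)]
  simp [bval]

theorem length_badd (x y : List Bool) : (badd x y).length = x.length + y.length + 1 := by
  have : ∀ (l : List Bool) s, (l.foldl (fun s _ => addStep s) s).2.2.length =
      s.2.2.length + l.length := by
    intro l
    induction l with
    | nil => simp
    | cons b l ih =>
      intro s
      rw [List.foldl_cons, ih]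
      simp [addStep]
      omega
  rw [badd, List.length_reverse, this]
  simp
  omega

/-- Multiplication of binary numbers. -/
def bmul (x y : List Bool) : List Bool :=
  x.reverse.foldl (fun s b => badd (false :: s) (if b then y else [])) []

/-- Horner's scheme, from the most significant bit of `x`. -/
theorem bval_bmul (x y : List Bool) : bval (bmul x y) = bval x * bval y := by
  rw [bmul, List.foldl_reverse]
  induction x with
  | nil => simp [bval]
  | cons b x ih =>
    rw [List.foldr_cons, bval_badd, bval, ih]
    cases b <;> simp [bval] <;> ring

/-- Comparison of binary numbers. -/
def bleList (x y : List Bool) : Bool :=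
  let s := x.foldl (fun s b => (s.1.tail, if b ^^ s.1.headD false then s.1.headD false else s.2))
    (y, true)
  !(s.1.filter fun b => b).isEmpty || s.2

/-- Digits are read from the least significant one, so each difference overrides the earlier
verdict. The initial verdict `r` is left general: it decides ties. A set bit left in `y` after `x`
is exhausted makes `y` larger. -/
theorem bleList_iff (x y : List Bool) : bleList x y = true ↔ bval x ≤ bval y := by
  have h₀ : ∀ y : List Bool, (y.filter fun b => b) = [] ↔ bval y = 0 := by
    intro y
    induction y with
    | nil => simp [bval]
    | cons b y ih => cases b <;> simp_all [bval]
  have : ∀ (x y : List Bool) (r : Bool),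
      let s := x.foldl (fun s b =>
        (s.1.tail, if b ^^ s.1.headD false then s.1.headD false else s.2)) (y, r)
      (!(s.1.filter fun b => b).isEmpty || s.2) = true ↔
        bval x < bval y ∨ (bval x = bval y ∧ r = true) := by
    intro x
    induction x with
    | nil =>
      intro y r
      have := h₀ y
      simp only [List.foldl_nil, Bool.or_eq_true, Bool.not_eq_true', List.isEmpty_eq_false_iff,
        ne_eq, bval, this]
      cases r <;> grind
    | cons b x ih =>
      intro y r
      rw [List.foldl_cons]
      refine (ih _ _).trans ?_
      rw [bval_eq_headD_tail y, bval]
      cases b <;> cases y.headD false <;> cases r <;> simp <;> omega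
  rw [bleList]
  refine (this x y true).trans ?_
  simp only [and_true]
  omega

/-! ### Binary arithmetic in polynomial time. -/

namespace PolyTime

variable {α : Type} [TreeEnc α]

theorem addStep : PolyTime _root_.addStep := by
  unfold _root_.addStep
  fun_prop

theorem esize_tail_le {β : Type} [TreeEnc β] (l : List β) : esize l.tail ≤ esize l := by
  cases l <;> simp; omega

@[fun_prop]
theorem badd {f g : α → List Bool} (hf : PolyTime f) (hg : PolyTime g) :
    PolyTime fun a => badd (f a) (g a) := by
  have h := addStep
  have := foldl (h := fun _ s (_ : Bool) => _root_.addStep s)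
    (f := fun a => f a ++ g a ++ [false]) (g := fun a => ((f a, g a), (false, [])))
    (by fun_prop) (by fun_prop) (by fun_prop) 7 (fun a s b => by
      have h₁ := esize_tail_le s.1.1
      have h₂ := esize_tail_le s.1.2
      have h₃ := esize_bool_le (_root_.addStep s).2.1
      have h₄ := esize_bool_le (s.1.1.headD false ^^ s.1.2.headD false ^^ s.2.1)
      simp only [_root_.addStep, esize_prod, esize_cons, Polynomial.eval_ofNat] at h₃ ⊢
      omega)
  unfold _root_.badd
  fun_prop

-- The accumulator is measured by its length: the codes of the two digits differ in size, so `esize`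
-- does not control the growth under addition as directly.
@[fun_prop]
theorem bmul {f g : α → List Bool} (hf : PolyTime f) (hg : PolyTime g) :
    PolyTime fun a => bmul (f a) (g a) := by
  have hE : ∀ s : List Bool, esize s ≤ 4 * s.length + 1 := by
    intro s
    induction s with
    | nil => simp
    | cons b s ih =>
      have := esize_bool_le b
      simp
      omega
  have : PolyTime fun p : List Bool × List Bool => _root_.bmul p.1 p.2 :=
    foldl_of_measure (f := fun p : List Bool × List Bool => p.1.reverse) (g := fun _ => [])
      (h := fun p s b => _root_.badd (false :: s) (if b then p.2 else []))
      (by fun_prop) (by fun_prop) (by fun_prop) List.length (4 * Polynomial.X + 1)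
      (by simpa using hE) (fun s => (length_lt_esize s).le) (Polynomial.X + 2) fun p s b => by
        have := length_lt_esize p.2
        cases b <;> simp [length_badd] <;> omega
  exact this.comp (hf.pair hg)

@[fun_prop]
theorem bleList {f g : α → List Bool} (hf : PolyTime f) (hg : PolyTime g) :
    PolyTime fun a => bleList (f a) (g a) := by
  have := foldl (h := fun _ (s : List Bool × Bool) (b : Bool) =>
      (s.1.tail, if b ^^ s.1.headD false then s.1.headD false else s.2)) hf
    (g := fun a => (g a, true)) (by fun_prop) (by fun_prop) 3 (fun a s b => by
      have h₁ := esize_tail_le s.1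
      have h₂ := esize_bool_le (if b ^^ s.1.headD false then s.1.headD false else s.2)
      simp only [esize_prod, Polynomial.eval_ofNat]
      omega)
  unfold _root_.bleList
  fun_prop

end PolyTime

/-! ### The decomposition on token lists -/

/-- Split a list of symbols, each token being terminated by a comma. -/
def tokens (s : List Symb) : List (List Bool) :=
  s.reverse.foldl (fun T c => if c.1 then (c.2 :: T.headD []) :: T.tail else [] :: T) []

namespace Tok

variable (T : List (List Bool))

/-- The number of letters. -/
def letters : ℕ := (T.getD 0 []).length

/-- The number of states. -/
def states : ℕ := (T.getD 1 []).length

/-- The initial state. -/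
def init : ℕ := (T.getD 2 []).length

/-- The number of transitions. -/
def trans : ℕ := states T * letters T

/-- The number of the transition from state `q` on letter `a`. -/
def idx (q a : ℕ) : ℕ := q * letters T + a

/-- The sign and the numerator of the weight of a transition. -/
def num (t : ℕ) : List Bool := T.getD (3 * t + 3) []

/-- The denominator of the weight of a transition. -/
def den (t : ℕ) : List Bool := T.getD (3 * t + 4) []

/-- The successor state of a transition. -/
def succ (t : ℕ) : ℕ := (T.getD (3 * t + 5) []).length

/-- Comparison of the weights of two transitions. -/
def weightLe (s t : ℕ) : Bool :=
  if (num T s).headD false then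
    if (num T t).headD false then
      bleList (bmul (num T t).tail (den T s)) (bmul (num T s).tail (den T t))
    else true
  else
    if (num T t).headD false then false
    else bleList (bmul (num T s).tail (den T t)) (bmul (num T t).tail (den T s))

/-- The rank of a transition: the number of transitions of at most its weight. -/
def rank (t : ℕ) : ℕ := ((List.range (trans T)).filter fun s => weightLe T s t).length

/-- One round of the computation of the best ranks. -/
def relax (b : List ℕ) : List ℕ :=
  (List.range (states T)).map fun q => ((List.range (letters T)).map fun a =>
    max (rank T (idx T q a)) (b.getD (succ T (idx T q a)) 0)).foldl max 0

/-- The best ranks that are reachable from the states. -/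
def bestTable : List ℕ :=
  -- The empty list stands for the zero table, as missing entries read as 0. Each round before
  -- stabilization raises the sum of the entries, which never exceeds `states T * trans T`.
  (List.replicate (states T * trans T + 1) ()).foldl (fun b _ => relax T b) []

/-- The best rank that is reachable from a state. -/
def best (q : ℕ) : ℕ := (bestTable T).getD q 0

/-- A transition of a given rank. -/
def sel (r : ℕ) : ℕ := ((List.range (trans T)).filter fun t => rank T t == r).headD 0

/-- The maximal rank so far after a transition. -/
def nextRank (m q a : ℕ) : ℕ := max m (rank T (idx T q a))

/-- The rank of the weight of the transition of the safety component from state `q` on letter `a`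
when the maximal rank so far is `m`. -/
def safeRank (m q _a : ℕ) : ℕ := max m (best T q)

/-- The rank of the weight of the transition of the liveness component from state `q` on letter
`a` when the maximal rank so far is `m`. -/
def liveRank (m q a : ℕ) : ℕ :=
  -- `trans T` is the rank of a transition of maximal weight.
  if (best T (succ T (idx T q a))).ble (nextRank T m q a) then trans T else nextRank T m q a

/-- The number of states of the components. -/
def prodStates : ℕ := (trans T + 1) * states T

/-- The number of a state of the components. -/
def prodState (m q : ℕ) : ℕ := m * states T + q

end Tok

/-- A token followed by a comma. -/
def tokSymb (l : List Bool) : List Symb := l.map (fun b => (true, b)) ++ [(false, false)]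

/-- A number in unary, followed by a comma. -/
def unarySymb (n : ℕ) : List Symb := tokSymb (List.replicate n true)

open Tok in
/-- The string of the component with a given function of ranks of weights. -/
def outSymb (T : List (List Bool)) (r : ℕ → ℕ → ℕ → ℕ) : List Symb :=
  unarySymb (letters T) ++ (unarySymb (prodStates T) ++ (unarySymb (init T) ++
    (List.range (trans T + 1)).flatMap fun m => (List.range (states T)).flatMap fun q =>
      (List.range (letters T)).flatMap fun a =>
        tokSymb (num T (sel T (r m q a))) ++ tokSymb (den T (sel T (r m q a))) ++
          unarySymb (prodState T (nextRank T m q a) (succ T (idx T q a)))))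

/-- The string of both components. -/
def decompSymb (T : List (List Bool)) : List Symb :=
  outSymb T (Tok.safeRank T) ++ outSymb T (Tok.liveRank T)

/-! ### The token-level construction in polynomial time. -/

namespace PolyTime

variable {α : Type} [TreeEnc α] {f : α → List (List Bool)} {g h i : α → ℕ}

theorem tokens : PolyTime tokens := by
  refine foldl (f := fun s : List Symb => s.reverse) (g := fun _ => [])
    (h := fun _ (T : List (List Bool)) (c : Symb) =>
      if c.1 then (c.2 :: T.headD []) :: T.tail else [] :: T)
    (by fun_prop) (by fun_prop) (by fun_prop) 10 fun s T c => ?_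
  have := esize_bool_le c.2
  obtain ⟨_ | _, b⟩ := c
  · simp; omega
  · cases T <;> simp at * <;> omega

@[fun_prop]
theorem letters (hf : PolyTime f) : PolyTime fun a => Tok.letters (f a) := by
  unfold Tok.letters; fun_prop

@[fun_prop]
theorem states (hf : PolyTime f) : PolyTime fun a => Tok.states (f a) := by
  unfold Tok.states; fun_prop

@[fun_prop]
theorem init (hf : PolyTime f) : PolyTime fun a => Tok.init (f a) := by
  unfold Tok.init; fun_prop

@[fun_prop]
theorem trans (hf : PolyTime f) : PolyTime fun a => Tok.trans (f a) := by
  unfold Tok.trans; fun_prop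

@[fun_prop]
theorem idx (hf : PolyTime f) (hg : PolyTime g) (hh : PolyTime h) :
    PolyTime fun a => Tok.idx (f a) (g a) (h a) := by
  unfold Tok.idx; fun_prop

@[fun_prop]
theorem num (hf : PolyTime f) (hg : PolyTime g) : PolyTime fun a => Tok.num (f a) (g a) := by
  unfold Tok.num; fun_prop

@[fun_prop]
theorem den (hf : PolyTime f) (hg : PolyTime g) : PolyTime fun a => Tok.den (f a) (g a) := by
  unfold Tok.den; fun_prop

@[fun_prop]
theorem succ (hf : PolyTime f) (hg : PolyTime g) : PolyTime fun a => Tok.succ (f a) (g a) := by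
  unfold Tok.succ; fun_prop

@[fun_prop]
theorem weightLe (hf : PolyTime f) (hg : PolyTime g) (hh : PolyTime h) :
    PolyTime fun a => Tok.weightLe (f a) (g a) (h a) := by
  unfold Tok.weightLe; fun_prop

@[fun_prop]
theorem rank (hf : PolyTime f) (hg : PolyTime g) : PolyTime fun a => Tok.rank (f a) (g a) := by
  unfold Tok.rank; fun_prop

@[fun_prop]
theorem relax {b : α → List ℕ} (hf : PolyTime f) (hb : PolyTime b) :
    PolyTime fun a => Tok.relax (f a) (b a) := by
  unfold Tok.relax; fun_prop

end PolyTime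

theorem List.foldl_max_le {l : List ℕ} {n : ℕ} (h : ∀ a ∈ l, a ≤ n) : l.foldl max 0 ≤ n := by
  have : ∀ (l : List ℕ) (s : ℕ), s ≤ n → (∀ a ∈ l, a ≤ n) → l.foldl max s ≤ n := by
    intro l
    induction l with
    | nil => simp
    | cons b l ih => intro s hs hl; exact ih _ (by simp at hl; omega) (by simp_all)
  exact this l 0 (Nat.zero_le n) h

/-! ### Bounds on ranks and on the table of best ranks. -/

namespace Tok

variable (T : List (List Bool))

theorem rank_le (t : ℕ) : rank T t ≤ trans T := by
  simpa [rank] using List.length_filter_le (fun s => weightLe T s t) (List.range (trans T))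

theorem relax_le {b : List ℕ} (hb : ∀ x ∈ b, x ≤ trans T) : ∀ x ∈ relax T b, x ≤ trans T := by
  intro x hx
  obtain ⟨q, -, rfl⟩ := List.mem_map.1 hx
  refine List.foldl_max_le fun y hy => ?_
  obtain ⟨a, -, rfl⟩ := List.mem_map.1 hy
  refine max_le (rank_le T _) ?_
  rw [List.getD_eq_getElem?_getD]
  cases h : b[succ T (idx T q a)]? with
  | none => simp
  | some y => exact hb y (List.mem_of_getElem? h)

theorem length_relax (b : List ℕ) : (relax T b).length = states T := by simp [relax]

theorem foldl_relax_le (l : List Unit) :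
    (∀ x ∈ l.foldl (fun b _ => relax T b) [], x ≤ trans T) ∧
      (l.foldl (fun b _ => relax T b) []).length ≤ states T := by
  induction l using List.reverseRecOn with
  | nil => simp
  | append_singleton l _ ih =>
    rw [List.foldl_append]
    exact ⟨relax_le T ih.1, (length_relax T _).le⟩

end Tok

namespace PolyTime

theorem esize_list_nat_le {l : List ℕ} {n k : ℕ} (h : ∀ x ∈ l, x ≤ n) (hl : l.length ≤ k) :
    esize l ≤ k * (2 * n + 2) + 1 := by
  rw [esize_list]
  have := List.sum_le_card_nsmul (l.map fun a => esize a + 1) (2 * n + 2) (by simp; exact h)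
  simp only [List.length_map, smul_eq_mul] at this
  have := Nat.mul_le_mul_right (2 * n + 2) hl
  omega

variable {α : Type} [TreeEnc α] {f : α → List (List Bool)} {g h i : α → ℕ}

/-- A round rewrites the whole table, so the size is controlled by an invariant: at most `states T`
entries, each at most `trans T`. -/
theorem bestTable : PolyTime Tok.bestTable := by
  have hB : PolyTime fun T => Tok.states T * (2 * Tok.trans T + 2) + 1 := by fun_prop
  obtain ⟨Q, hQ⟩ := hB.exists_size_le
  refine foldl_of_bound (f := fun T => List.replicate (Tok.states T * Tok.trans T + 1) ())
    (g := fun _ => ([] : List ℕ)) (h := fun x : List (List Bool) × (List ℕ × Unit) =>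
      Tok.relax x.1 x.2.1) (by fun_prop) (by fun_prop) (by fun_prop) Q fun T l₁ l₂ _ => ?_
  obtain ⟨h₁, h₂⟩ := Tok.foldl_relax_le T l₁
  have h₃ := esize_list_nat_le h₁ h₂
  have h₄ := hQ T
  rw [esize_nat] at h₄
  exact h₃.trans (by omega)

@[fun_prop]
theorem best (hf : PolyTime f) (hg : PolyTime g) : PolyTime fun a => Tok.best (f a) (g a) := by
  have := bestTable.comp hf
  unfold Tok.best; fun_prop

@[fun_prop]
theorem sel (hf : PolyTime f) (hg : PolyTime g) : PolyTime fun a => Tok.sel (f a) (g a) := by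
  unfold Tok.sel; fun_prop

@[fun_prop]
theorem nextRank (hf : PolyTime f) (hg : PolyTime g) (hh : PolyTime h) (hi : PolyTime i) :
    PolyTime fun a => Tok.nextRank (f a) (g a) (h a) (i a) := by
  unfold Tok.nextRank; fun_prop

@[fun_prop]
theorem safeRank (hf : PolyTime f) (hg : PolyTime g) (hh : PolyTime h) :
    PolyTime fun a => Tok.safeRank (f a) (g a) (h a) (i a) := by
  unfold Tok.safeRank; fun_prop

@[fun_prop]
theorem liveRank (hf : PolyTime f) (hg : PolyTime g) (hh : PolyTime h) (hi : PolyTime i) :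
    PolyTime fun a => Tok.liveRank (f a) (g a) (h a) (i a) := by
  unfold Tok.liveRank; fun_prop

@[fun_prop]
theorem prodStates (hf : PolyTime f) : PolyTime fun a => Tok.prodStates (f a) := by
  unfold Tok.prodStates; fun_prop

@[fun_prop]
theorem prodState (hf : PolyTime f) (hg : PolyTime g) (hh : PolyTime h) :
    PolyTime fun a => Tok.prodState (f a) (g a) (h a) := by
  unfold Tok.prodState; fun_prop

@[fun_prop]
theorem tokSymb {f : α → List Bool} (hf : PolyTime f) : PolyTime fun a => tokSymb (f a) := by
  unfold _root_.tokSymb; fun_prop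

@[fun_prop]
theorem unarySymb (hg : PolyTime g) : PolyTime fun a => unarySymb (g a) := by
  unfold _root_.unarySymb; fun_prop

@[fun_prop]
theorem outSymb {r : α → ℕ → ℕ → ℕ → ℕ} (hf : PolyTime f)
    (hr : PolyTime fun p : α × (ℕ × (ℕ × ℕ)) => r p.1 p.2.1 p.2.2.1 p.2.2.2) :
    PolyTime fun a => outSymb (f a) (r a) := by
  -- The nested `flatMap`s supply their variables as left-nested pairs.
  have hr' : PolyTime fun p : ((α × ℕ) × ℕ) × ℕ => r p.1.1.1 p.1.1.2 p.1.2 p.2 :=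
    hr.comp (f := fun p : ((α × ℕ) × ℕ) × ℕ => (p.1.1.1, (p.1.1.2, (p.1.2, p.2)))) (by fun_prop)
  unfold _root_.outSymb; fun_prop

theorem decompSymb : PolyTime decompSymb := by
  unfold _root_.decompSymb; fun_prop

end PolyTime

/-! ### Deterministic automata and their runs -/

namespace DetAut

variable {k : ℕ}

/-- By determinism any two runs on `w` agree step by step, so the supremum over runs is attained by
the given one. -/
theorem value_eq {A : DetAut k} {w : ℕ → Fin k} {q : ℕ → Fin A.numStates} {x : ℕ → ℚ}
    (h : A.aut.IsRun w q x) (Val : (ℕ → ℚ) → EReal) : A.aut.value Val w = Val x := by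
  have huniq : ∀ q' x', A.aut.IsRun w q' x' → x' = x := by
    rintro q' x' ⟨h₀, h₁⟩
    have key : ∀ i, q' i = q i ∧ x' i = x i := by
      have step : ∀ i, q' i = q i → (x' i, q' (i + 1)) = (x i, q (i + 1)) := by
        intro i hi
        have h₂ := h₁ i
        have h₃ := h.2 i
        rw [hi, A.δ_eq, Finset.mem_singleton] at h₂
        rw [A.δ_eq, Finset.mem_singleton] at h₃
        rw [h₂, h₃]
      have hq : ∀ i, q' i = q i := by
        intro i
        induction i with
        | zero => rw [h₀, h.1]
        | succ i ih => exact congrArg Prod.snd (step i ih)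
      exact fun i => ⟨hq i, congrArg Prod.fst (step i (hq i))⟩
    exact funext fun i => (key i).2
  refine le_antisymm ?_ ?_
  · exact iSup_le fun q' => iSup_le fun x' => iSup_le fun h' => by rw [huniq q' x' h']
  · exact le_iSup_of_le q (le_iSup_of_le x (le_iSup_of_le h le_rfl))

/-- The states of the run from a given state on a word. -/
noncomputable def runFrom (A : DetAut k) (q : Fin A.numStates) (w : ℕ → Fin k) :
    ℕ → Fin A.numStates
  | 0 => q
  | i + 1 => (A.trans (runFrom A q w i) (w i)).2

theorem isRun_runFrom (A : DetAut k) (w : ℕ → Fin k) :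
    A.aut.IsRun w (A.runFrom A.aut.init w)
      (fun i => (A.trans (A.runFrom A.aut.init w i) (w i)).1) :=
  ⟨rfl, fun i => by rw [A.δ_eq, Finset.mem_singleton]; rfl⟩

theorem runFrom_congr (A : DetAut k) (q : Fin A.numStates) {w w' : ℕ → Fin k} {n : ℕ}
    (h : ∀ i < n, w i = w' i) : ∀ i ≤ n, A.runFrom q w i = A.runFrom q w' i := by
  intro i
  induction i with
  | zero => exact fun _ => rfl
  | succ i ih => intro hi; rw [runFrom, runFrom, ih (by omega), h i (by omega)]

theorem runFrom_shift (A : DetAut k) (q : Fin A.numStates) (w : ℕ → Fin k) (n i : ℕ) :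
    A.runFrom q w (n + i) = A.runFrom (A.runFrom q w n) (fun j => w (n + j)) i := by
  induction i with
  | zero => rfl
  | succ i ih => rw [← Nat.add_assoc, runFrom, ih, runFrom]

theorem prefixAppend_of_lt {S : Type} {w w' : ℕ → S} {n i : ℕ} (h : i < n) :
    prefixAppend w n w' i = w i := if_pos h

theorem prefixAppend_add {S : Type} (w w' : ℕ → S) (n i : ℕ) :
    prefixAppend w n w' (n + i) = w' i := by simp [prefixAppend]

/-- Deterministic `Inf`-automata are safe. -/
theorem isSafe_infVal (A : DetAut k) : IsSafe (A.aut.value infVal) := by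
  intro w v hv
  rw [value_eq (A.isRun_runFrom w), infVal, le_iInf_iff] at hv
  push Not at hv
  obtain ⟨i, hi⟩ := hv
  -- The weight at position `i` is below `v`, and the first `i + 1` letters fix it for all
  -- continuations.
  refine ⟨i + 1, fun hle => ?_⟩
  refine absurd (hle.trans (iSup_le fun w' => ?_)) (not_le.2 hi)
  rw [value_eq (A.isRun_runFrom (prefixAppend w (i + 1) w')), infVal]
  refine (iInf_le _ i).trans (le_of_eq ?_)
  rw [prefixAppend_of_lt (Nat.lt_succ_self i), A.runFrom_congr _ (w' := w) (n := i)
    (fun j hj => prefixAppend_of_lt (by omega)) i le_rfl]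

/-! ### Rankings of the weights and the two components -/

/-- The weights of an automaton replaced by natural numbers in the same order, together with the
best reachable ranks. -/
structure Ranking (A : DetAut k) where
  /-- the rank of a transition -/
  rank : Fin A.numStates → Fin k → ℕ
  /-- the best rank that is reachable from a state -/
  best : Fin A.numStates → ℕ
  /-- the greatest rank -/
  top : ℕ
  /-- the weight of a rank -/
  weight : ℕ → ℚ
  rank_le_top : ∀ q a, rank q a ≤ top
  weight_rank : ∀ q a, weight (rank q a) = (A.trans q a).1
  weight_mono : ∀ q a q' a', rank q a ≤ rank q' a' → (A.trans q a).1 ≤ (A.trans q' a').1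
  weight_le_top : ∀ q a, (A.trans q a).1 ≤ weight top
  rank_le_best : ∀ q a, rank q a ≤ best q
  best_succ_le : ∀ q a, best (A.trans q a).2 ≤ best q
  -- The letter excludes the empty alphabet, over which no word could serve as a witness.
  exists_rank_eq_best : ∀ (q) (_ : Fin k), ∃ w i, rank (A.runFrom q w i) (w i) = best q

namespace Ranking

variable {A : DetAut k} (R : Ranking A)

/-- The automaton with states of `A` and maximal ranks so far, where the weight of a transition
has the rank given by `r`. -/
noncomputable def prod (r : ℕ → Fin A.numStates → Fin k → ℕ) : DetAut k where
  numStates := (R.top + 1) * A.numStates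
  aut :=
    { init := finProdFinEquiv (0, A.aut.init)
      δ := fun s a =>
        {(R.weight (r (finProdFinEquiv.symm s).1 (finProdFinEquiv.symm s).2 a),
          finProdFinEquiv (⟨max (finProdFinEquiv.symm s).1 (R.rank (finProdFinEquiv.symm s).2 a),
            by have := R.rank_le_top (finProdFinEquiv.symm s).2 a; omega⟩,
            (A.trans (finProdFinEquiv.symm s).2 a).2))}
      total := fun _ _ => Finset.singleton_nonempty _ }
  det := fun _ _ => ⟨_, rfl⟩

/-- The maximal rank of the first transitions of the run on a word. -/
noncomputable def maxRank (w : ℕ → Fin k) : ℕ → ℕ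
  | 0 => 0
  | i + 1 => max (maxRank w i) (R.rank (A.runFrom A.aut.init w i) (w i))

theorem maxRank_le_top (w : ℕ → Fin k) (i : ℕ) : R.maxRank w i ≤ R.top := by
  induction i with
  | zero => exact Nat.zero_le _
  | succ i ih => exact max_le ih (R.rank_le_top _ _)

theorem value_prod (r : ℕ → Fin A.numStates → Fin k → ℕ) (Val : (ℕ → ℚ) → EReal)
    (w : ℕ → Fin k) :
    (R.prod r).aut.value Val w =
      Val fun i => R.weight (r (R.maxRank w i) (A.runFrom A.aut.init w i) (w i)) := by
  refine value_eq (q := fun i => finProdFinEquiv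
    (⟨R.maxRank w i, Nat.lt_succ_of_le (R.maxRank_le_top w i)⟩, A.runFrom A.aut.init w i))
    ⟨rfl, fun i => ?_⟩ Val
  refine Finset.mem_singleton.2 ?_
  simp only [Equiv.symm_apply_apply]
  rfl

theorem maxRank_mono (w : ℕ → Fin k) : Monotone (R.maxRank w) :=
  monotone_nat_of_le_succ fun _ => le_max_left _ _

theorem rank_le_maxRank (w : ℕ → Fin k) {i j : ℕ} (h : i < j) :
    R.rank (A.runFrom A.aut.init w i) (w i) ≤ R.maxRank w j :=
  (le_max_right _ _).trans (R.maxRank_mono w h)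

/-- After at least one transition the running maximum is the rank of a transition; the initial 0 is
only a placeholder. This matters because `weight` is specified at ranks of transitions, apart from
the bound at `top`. -/
theorem exists_maxRank_eq (w : ℕ → Fin k) (i : ℕ) :
    ∃ j ≤ i, R.maxRank w (i + 1) = R.rank (A.runFrom A.aut.init w j) (w j) := by
  induction i with
  | zero => exact ⟨0, le_rfl, by simp [maxRank]⟩
  | succ i ih =>
    obtain ⟨j, hj, e⟩ := ih
    rw [maxRank]
    rcases max_choice (R.maxRank w (i + 1))
      (R.rank (A.runFrom A.aut.init w (i + 1)) (w (i + 1))) with h | h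
    · exact ⟨j, by omega, h.trans e⟩
    · exact ⟨i + 1, le_rfl, h⟩

theorem best_antitone (w : ℕ → Fin k) : Antitone fun i => R.best (A.runFrom A.aut.init w i) :=
  antitone_nat_of_succ_le fun _ => R.best_succ_le _ _

/-- The rank of the weights of the safety component. -/
def safeRank (m : ℕ) (q : Fin A.numStates) (_ : Fin k) : ℕ := max m (R.best q)

/-- The rank of the weights of the liveness component. -/
noncomputable def liveRank (m : ℕ) (q : Fin A.numStates) (a : Fin k) : ℕ :=
  if R.best (A.trans q a).2 ≤ max m (R.rank q a) then R.top else max m (R.rank q a)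

/-- The safety component. -/
noncomputable def safe : DetAut k := R.prod R.safeRank

/-- The liveness component. -/
noncomputable def live : DetAut k := R.prod R.liveRank

theorem weight_mono_of_valid {q q' : Fin A.numStates} {a a' : Fin k} {r r' : ℕ}
    (h : r ≤ r') (hr : r = R.rank q a) (hr' : r' = R.rank q' a') : R.weight r ≤ R.weight r' := by
  subst hr hr'
  rw [R.weight_rank, R.weight_rank]
  exact R.weight_mono _ _ _ _ h

theorem exists_rank_eq_max_best (w : ℕ → Fin k) (i : ℕ) :
    ∃ q a, max (R.maxRank w i) (R.best (A.runFrom A.aut.init w i)) = R.rank q a := by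
  obtain ⟨w', j, h⟩ := R.exists_rank_eq_best (A.runFrom A.aut.init w i) (w 0)
  cases i with
  | zero => exact ⟨_, _, by simpa [maxRank] using h.symm⟩
  | succ i =>
    obtain ⟨l, -, e⟩ := R.exists_maxRank_eq w i
    rcases max_choice (R.maxRank w (i + 1)) (R.best (A.runFrom A.aut.init w (i + 1))) with h' | h'
    · exact ⟨_, _, h'.trans e⟩
    · exact ⟨_, _, h'.trans h.symm⟩

theorem value_sup (w : ℕ → Fin k) :
    A.aut.value supVal w =
      ⨆ i, ((R.weight (R.rank (A.runFrom A.aut.init w i) (w i)) : ℝ) : EReal) := by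
  rw [value_eq (A.isRun_runFrom w), supVal]
  simp only [R.weight_rank]

theorem value_safe (w : ℕ → Fin k) :
    R.safe.aut.value infVal w =
      ⨅ i, ((R.weight (max (R.maxRank w i) (R.best (A.runFrom A.aut.init w i))) : ℝ) : EReal) :=
  R.value_prod _ _ _

theorem value_live (w : ℕ → Fin k) :
    R.live.aut.value supVal w =
      ⨆ i, ((R.weight (if R.best (A.runFrom A.aut.init w (i + 1)) ≤ R.maxRank w (i + 1)
        then R.top else R.maxRank w (i + 1)) : ℝ) : EReal) :=
  R.value_prod _ _ _

theorem coe_le_coe {x y : ℚ} (h : x ≤ y) : ((x : ℝ) : EReal) ≤ ((y : ℝ) : EReal) := by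
  exact_mod_cast h

theorem weight_le_weight_top {r : ℕ} {q : Fin A.numStates} {a : Fin k} (hr : r = R.rank q a) :
    R.weight r ≤ R.weight R.top := by
  subst hr
  rw [R.weight_rank]
  exact R.weight_le_top q a

theorem value_live_le (w : ℕ → Fin k) :
    R.live.aut.value supVal w ≤ ((R.weight R.top : ℝ) : EReal) := by
  rw [value_live]
  refine iSup_le fun i => coe_le_coe ?_
  split_ifs
  · exact le_rfl
  · obtain ⟨j, -, e⟩ := R.exists_maxRank_eq w i
    exact R.weight_le_weight_top e

theorem le_value_live {w : ℕ → Fin k} {i : ℕ}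
    (h : R.best (A.runFrom A.aut.init w (i + 1)) ≤ R.maxRank w (i + 1)) :
    ((R.weight R.top : ℝ) : EReal) ≤ R.live.aut.value supVal w := by
  rw [value_live]
  refine le_iSup_of_le i ?_
  rw [if_pos h]

/-- Any prefix can be continued to a transition of the best rank available after it. The running
maximum has then caught up with everything still reachable, so the top weight is emitted. -/
theorem isLive_live : IsLive (R.live.aut.value supVal) := by
  intro w hw
  refine ⟨((R.weight R.top : ℝ) : EReal), not_le.2 (hw.trans_le (iSup_le R.value_live_le)),
    fun n => ?_⟩
  obtain ⟨w', i, h⟩ := R.exists_rank_eq_best (A.runFrom A.aut.init w n) (w 0)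
  refine le_iSup_of_le w' (R.le_value_live (i := n + i) ?_)
  set u := prefixAppend w n w' with hu
  have h₀ : A.runFrom A.aut.init u n = A.runFrom A.aut.init w n :=
    A.runFrom_congr _ (fun j hj => prefixAppend_of_lt hj) n le_rfl
  have h₁ : (fun j => u (n + j)) = w' := funext fun j => prefixAppend_add w w' n j
  have h₂ : A.runFrom A.aut.init u (n + i) = A.runFrom (A.runFrom A.aut.init w n) w' i := by
    rw [runFrom_shift, h₀, h₁]
  -- The best rank after step `n + i` is at most the one after the prefix, which step `n + i`
  -- attains.
  have h₃ := R.best_antitone u (show n ≤ n + i + 1 by omega)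
  have h₄ := R.rank_le_maxRank u (Nat.lt_succ_self (n + i))
  rw [h₂, hu, prefixAppend_add, ← hu, h] at h₄
  simp only [h₀] at h₃
  exact h₃.trans h₄

theorem value_le_value_safe (w : ℕ → Fin k) :
    A.aut.value supVal w ≤ R.safe.aut.value infVal w := by
  rw [R.value_sup, R.value_safe]
  refine iSup_le fun i => le_iInf fun j => coe_le_coe ?_
  obtain ⟨q, a, e⟩ := R.exists_rank_eq_max_best w j
  refine R.weight_mono_of_valid ?_ rfl e
  -- Transitions before `j` are counted in the running maximum; later ones are bounded by the best
  -- rank at `j`.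
  rcases lt_or_ge i j with h | h
  · exact (R.rank_le_maxRank w h).trans (le_max_left _ _)
  · exact ((R.rank_le_best _ _).trans (R.best_antitone w h)).trans (le_max_right _ _)

theorem weight_maxRank_le_value (w : ℕ → Fin k) (i : ℕ) :
    ((R.weight (R.maxRank w (i + 1)) : ℝ) : EReal) ≤ A.aut.value supVal w := by
  obtain ⟨j, -, e⟩ := R.exists_maxRank_eq w i
  rw [e, R.value_sup]
  exact le_iSup (fun i => ((R.weight (R.rank (A.runFrom A.aut.init w i) (w i)) : ℝ) : EReal)) j

/-- If the running maximum catches up with the best reachable rank, the safety component is exact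
from there on and the liveness component is at the top. If it never does, the liveness component
emits exactly the running maxima, whose supremum is the value of the automaton. -/
theorem value_eq_min (w : ℕ → Fin k) :
    A.aut.value supVal w = min (R.safe.aut.value infVal w) (R.live.aut.value supVal w) := by
  by_cases h : ∃ i, R.best (A.runFrom A.aut.init w (i + 1)) ≤ R.maxRank w (i + 1)
  · obtain ⟨i, hi⟩ := h
    have h₁ : R.safe.aut.value infVal w ≤ A.aut.value supVal w := by
      refine le_trans ?_ (R.weight_maxRank_le_value w i)
      rw [R.value_safe]
      exact (iInf_le _ (i + 1)).trans (by rw [max_eq_left hi])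
    have h₂ : A.aut.value supVal w ≤ R.live.aut.value supVal w := by
      refine le_trans ?_ (R.le_value_live hi)
      rw [R.value_sup]
      exact iSup_le fun j => coe_le_coe (R.weight_le_weight_top rfl)
    exact le_antisymm (le_min (R.value_le_value_safe w) h₂) ((min_le_left _ _).trans h₁)
  · push Not at h
    have h₁ : R.live.aut.value supVal w = A.aut.value supVal w := by
      refine le_antisymm ?_ ?_
      · rw [R.value_live]
        refine iSup_le fun i => ?_
        rw [if_neg (not_le.2 (h i))]
        exact R.weight_maxRank_le_value w i
      · rw [R.value_live, R.value_sup]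
        refine iSup_mono fun i => ?_
        rw [if_neg (not_le.2 (h i))]
        obtain ⟨j, -, e⟩ := R.exists_maxRank_eq w i
        exact coe_le_coe (R.weight_mono_of_valid (R.rank_le_maxRank w (Nat.lt_succ_self i)) rfl e)
    rw [h₁, min_eq_right (R.value_le_value_safe w)]

end Ranking

end DetAut

/-! ### Properties of the computed ranks -/

theorem List.foldl_max_map_range (g : ℕ → ℕ) (n : ℕ) :
    ((List.range n).map g).foldl max 0 = (Finset.range n).sup g := by
  induction n with
  | zero => rfl
  | succ n ih =>
    rw [List.range_succ, List.map_append, List.foldl_append, ih, Finset.range_add_one,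
      Finset.sup_insert]
    exact max_comm _ _

namespace Tok

variable (T : List (List Bool))

/-- The best ranks that are reachable from a state by at most `i` transitions. -/
def bestUpTo (i q : ℕ) : ℕ :=
  ((List.replicate i ()).foldl (fun b _ => relax T b) []).getD q 0

theorem best_eq (q : ℕ) : best T q = bestUpTo T (states T * trans T + 1) q := rfl

theorem bestUpTo_zero (q : ℕ) : bestUpTo T 0 q = 0 := by simp [bestUpTo]

theorem bestUpTo_succ {i q : ℕ} (hq : q < states T) :
    bestUpTo T (i + 1) q = (Finset.range (letters T)).sup fun a =>
      max (rank T (idx T q a)) (bestUpTo T i (succ T (idx T q a))) := by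
  rw [bestUpTo, List.replicate_succ', List.foldl_append, ← List.foldl_max_map_range]
  simp [relax, hq, bestUpTo]

theorem bestUpTo_of_le {i q : ℕ} (hq : states T ≤ q) : bestUpTo T i q = 0 := by
  rw [bestUpTo, List.getD_eq_getElem?_getD, List.getElem?_eq_none, Option.getD_none]
  exact ((foldl_relax_le T _).2).trans hq

theorem bestUpTo_le_trans (i q : ℕ) : bestUpTo T i q ≤ trans T := by
  rw [bestUpTo, List.getD_eq_getElem?_getD]
  generalize h : ((List.replicate i ()).foldl (fun b _ => relax T b) [])[q]? = o
  cases o with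
  | none => simp
  | some y => exact (foldl_relax_le T _).1 y (List.mem_of_getElem? h)

theorem bestUpTo_mono (i q : ℕ) : bestUpTo T i q ≤ bestUpTo T (i + 1) q := by
  induction i generalizing q with
  | zero => simp [bestUpTo_zero]
  | succ i ih =>
    rcases lt_or_ge q (states T) with hq | hq
    · rw [bestUpTo_succ T hq, bestUpTo_succ T hq]
      exact Finset.sup_mono_fun fun a _ => max_le_max le_rfl (ih _)
    · rw [bestUpTo_of_le T hq]
      exact Nat.zero_le _

/-- Entries never decrease, so each round that changes the table raises its sum by at least one, and
a table left unchanged once stays unchanged. -/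
theorem le_sum_bestUpTo_or (i : ℕ) :
    i ≤ ∑ q ∈ Finset.range (states T), bestUpTo T i q ∨
      ∀ q, bestUpTo T (i + 1) q = bestUpTo T i q := by
  induction i with
  | zero => exact .inl (Nat.zero_le _)
  | succ i ih =>
    by_cases h : ∀ q, bestUpTo T (i + 1) q = bestUpTo T i q
    · refine .inr fun q => ?_
      rcases lt_or_ge q (states T) with hq | hq
      · rw [bestUpTo_succ T hq, bestUpTo_succ T hq]
        simp only [h]
      · rw [bestUpTo_of_le T hq, bestUpTo_of_le T hq]
    · refine .inl ?_
      have h₁ := ih.resolve_right h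
      push Not at h
      obtain ⟨q, hq⟩ := h
      have hlt : q < states T := by
        by_contra hge
        exact hq (by rw [bestUpTo_of_le T (not_lt.1 hge), bestUpTo_of_le T (not_lt.1 hge)])
      have := Finset.sum_lt_sum (s := Finset.range (states T))
        (fun q _ => bestUpTo_mono T i q)
        ⟨q, Finset.mem_range.2 hlt, lt_of_le_of_ne (bestUpTo_mono T i q) (Ne.symm hq)⟩
      omega

/-- The sum of the table is at most `states T * trans T`, fewer than the number of rounds, so the
iteration has reached its fixed point. -/
theorem best_eq_sup {q : ℕ} (hq : q < states T) :
    best T q = (Finset.range (letters T)).sup fun a =>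
      max (rank T (idx T q a)) (best T (succ T (idx T q a))) := by
  have h : ∀ q, bestUpTo T (states T * trans T + 1 + 1) q =
      bestUpTo T (states T * trans T + 1) q := by
    refine (le_sum_bestUpTo_or T _).resolve_left (not_le.2 ?_)
    refine Nat.lt_succ_of_le ?_
    simpa using Finset.sum_le_card_nsmul (Finset.range (states T)) _ _
      fun q _ => bestUpTo_le_trans T (states T * trans T + 1) q
  rw [best_eq, ← h, bestUpTo_succ T hq]
  rfl

theorem rank_le_best {q a : ℕ} (hq : q < states T) (ha : a < letters T) :
    rank T (idx T q a) ≤ best T q := by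
  rw [best_eq_sup T hq]
  exact (le_max_left _ _).trans (Finset.le_sup (f := fun a =>
      max (rank T (idx T q a)) (best T (succ T (idx T q a)))) (Finset.mem_range.2 ha))

theorem best_succ_le {q a : ℕ} (hq : q < states T) (ha : a < letters T) :
    best T (succ T (idx T q a)) ≤ best T q := by
  rw [best_eq_sup T hq]
  exact (le_max_right _ _).trans (Finset.le_sup (f := fun a =>
      max (rank T (idx T q a)) (best T (succ T (idx T q a)))) (Finset.mem_range.2 ha))

theorem rank_eq_card (t : ℕ) :
    rank T t = ((Finset.range (trans T)).filter fun s => weightLe T s t = true).card := by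
  simp [rank, Finset.card, Finset.filter, Finset.range, Multiset.range]

/-! ### Ranks represent the order of the weights. -/

section Order

variable {T} {wt : ℕ → ℚ}
  (hwt : ∀ s < trans T, ∀ t < trans T, weightLe T s t = true ↔ wt s ≤ wt t)
include hwt

/-- Ranks are cardinalities of down-sets. A larger weight has a strictly larger down-set, since it
contains the transition itself. -/
theorem rank_le_rank_iff {s t : ℕ} (hs : s < trans T) (ht : t < trans T) :
    rank T s ≤ rank T t ↔ wt s ≤ wt t := by
  constructor
  · intro h
    by_contra hlt
    push Not at hlt
    refine absurd h (not_le.2 ?_)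
    rw [rank_eq_card, rank_eq_card]
    refine Finset.card_lt_card (Finset.ssubset_iff_of_subset ?_ |>.2 ⟨s, ?_, ?_⟩)
    · intro u hu
      simp only [Finset.mem_filter, Finset.mem_range] at hu ⊢
      exact ⟨hu.1, (hwt u hu.1 s hs).2 (((hwt u hu.1 t ht).1 hu.2).trans hlt.le)⟩
    · simp [hs, hwt s hs s hs]
    · simp [hs, hwt s hs t ht, hlt]
  · intro h
    rw [rank_eq_card, rank_eq_card]
    refine Finset.card_le_card fun u hu => ?_
    simp only [Finset.mem_filter, Finset.mem_range] at hu ⊢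
    exact ⟨hu.1, (hwt u hu.1 t ht).2 (((hwt u hu.1 s hs).1 hu.2).trans h)⟩

theorem rank_pos {t : ℕ} (ht : t < trans T) : 0 < rank T t := by
  rw [rank_eq_card, Finset.card_pos]
  exact ⟨t, by simp [ht, hwt t ht t ht]⟩

theorem exists_rank_eq_trans {t : ℕ} (ht : t < trans T) :
    ∃ s < trans T, rank T s = trans T ∧ ∀ u < trans T, wt u ≤ wt s := by
  obtain ⟨s, hs, hmax⟩ := Finset.exists_max_image (Finset.range (trans T)) wt
    ⟨t, Finset.mem_range.2 ht⟩
  simp only [Finset.mem_range] at hs hmax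
  refine ⟨s, hs, ?_, hmax⟩
  rw [rank_eq_card, Finset.filter_true_of_mem, Finset.card_range]
  intro u hu
  rw [Finset.mem_range] at hu
  exact (hwt u hu s hs).2 (hmax u hu)

theorem wt_sel {t : ℕ} (ht : t < trans T) : wt (sel T (rank T t)) = wt t := by
  have key : sel T (rank T t) ∈ (List.range (trans T)).filter fun u => rank T u == rank T t := by
    have hmem : t ∈ (List.range (trans T)).filter fun u => rank T u == rank T t := by simp [ht]
    rw [sel]
    generalize (List.range (trans T)).filter (fun u => rank T u == rank T t) = l at hmem
    cases l with
    | nil => simp at hmem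
    | cons a l => simp
  simp only [List.mem_filter, List.mem_range, beq_iff_eq] at key
  exact le_antisymm ((rank_le_rank_iff hwt key.1 ht).1 key.2.le)
    ((rank_le_rank_iff hwt ht key.1).1 key.2.ge)

end Order

theorem sel_lt {r : ℕ} (h : 0 < trans T) : sel T r < trans T := by
  rw [sel]
  generalize hl : (List.range (trans T)).filter (fun u => rank T u == r) = l
  cases l with
  | nil => simpa using h
  | cons a l =>
    have : a ∈ (List.range (trans T)).filter (fun u => rank T u == r) := by simp [hl]
    simpa using (List.mem_filter.1 this).1

end Tok

/-- Numbers, signs and numerators as they are compared by `Tok.weightLe`. -/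
theorem Rat.le_iff_natAbs (x y : ℚ) :
    x ≤ y ↔ if x < 0 then (if y < 0 then y.num.natAbs * x.den ≤ x.num.natAbs * y.den else True)
      else (if y < 0 then False else x.num.natAbs * y.den ≤ y.num.natAbs * x.den) := by
  have hx : x < 0 ↔ x.num < 0 := Rat.num_neg.symm
  have hy : y < 0 ↔ y.num < 0 := Rat.num_neg.symm
  have h : x ≤ y ↔ x.num * y.den ≤ y.num * x.den := Rat.le_iff x y
  split_ifs with h₁ h₂ h₂
  · rw [h]
    have e₁ : x.num = -(x.num.natAbs : ℤ) := by have := hx.1 h₁; omega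
    have e₂ : y.num = -(y.num.natAbs : ℤ) := by have := hy.1 h₂; omega
    rw [e₁, e₂, neg_mul, neg_mul, neg_le_neg_iff, Int.natAbs_neg, Int.natAbs_neg,
      Int.natAbs_natCast, Int.natAbs_natCast]
    exact_mod_cast Iff.rfl
  · simp only [iff_true]
    exact h₁.le.trans (not_lt.1 h₂)
  · simp only [iff_false, not_le]
    exact h₂.trans_le (not_lt.1 h₁)
  · rw [h]
    have e₁ : x.num = (x.num.natAbs : ℤ) := by have := mt hx.2 h₁; omega
    have e₂ : y.num = (y.num.natAbs : ℤ) := by have := mt hy.2 h₂; omega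
    rw [e₁, e₂, Int.natAbs_natCast, Int.natAbs_natCast]
    exact_mod_cast Iff.rfl

/-! ### Tokens of encodings of automata -/

theorem tokens_tokSymb_append (l : List Bool) (s : List Symb) :
    tokens (tokSymb l ++ s) = l :: tokens s := by
  have h : ∀ s, tokens s =
      s.foldr (fun c T => if c.1 then (c.2 :: T.headD []) :: T.tail else [] :: T) [] :=
    fun s => List.foldl_reverse
  rw [h, h, tokSymb, List.append_assoc]
  induction l with
  | nil => rfl
  | cons b l ih => rw [List.map_cons, List.cons_append, List.foldr_cons, ih]; rfl

theorem tokens_flatMap_tokSymb (L : List (List Bool)) : tokens (L.flatMap tokSymb) = L := by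
  induction L with
  | nil => rfl
  | cons l L ih => rw [List.flatMap_cons, tokens_tokSymb_append, ih]

theorem map_encUnary (n : ℕ) : (encUnary n).map Symb.ofΓ' = tokSymb (List.replicate n true) := by
  simp [encUnary, tokSymb, Symb.ofΓ']

theorem map_encBinary (n : ℕ) : (encBinary n).map Symb.ofΓ' = tokSymb (encodeNat n) := by
  simp [encBinary, tokSymb, Symb.ofΓ']

/-- The tokens of a transition. -/
def transTokens (x : ℚ) (q : ℕ) : List (List Bool) :=
  [decide (x < 0) :: encodeNat x.num.natAbs, encodeNat x.den, List.replicate q true]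

theorem map_encRat_append_encUnary (x : ℚ) (q : ℕ) :
    (encRat x ++ encUnary q).map Symb.ofΓ' = (transTokens x q).flatMap tokSymb := by
  simp only [encRat, List.map_append, List.map_cons, map_encUnary, map_encBinary]
  simp [transTokens, tokSymb, Symb.ofΓ']

/-- The tokens of an automaton. -/
noncomputable def autTokens {k : ℕ} (A : DetAut k) : List (List Bool) :=
  List.replicate k true :: List.replicate A.numStates true ::
    List.replicate (A.aut.init : ℕ) true ::
    (List.finRange A.numStates).flatMap fun q => (List.finRange k).flatMap fun a =>
      transTokens (A.trans q a).1 (A.trans q a).2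

theorem tokens_encAut {k : ℕ} (A : DetAut k) :
    tokens ((encAut A).map Symb.ofΓ') = autTokens A := by
  rw [← tokens_flatMap_tokSymb (autTokens A)]
  congr 1
  simp only [encAut, autTokens, List.map_append, List.map_flatMap, List.flatMap_cons,
    map_encUnary, List.flatMap_assoc, ← map_encRat_append_encUnary]

/-- Random access in a concatenation of blocks of equal length `c`: division by `c` with remainder.
-/
theorem List.getD_flatMap_of_length_eq {α β : Type} {f : α → List β} {c : ℕ} {L : List α}
    (hf : ∀ a ∈ L, (f a).length = c) (d : β) : ∀ {i j : ℕ} (hi : i < L.length), j < c →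
    (L.flatMap f).getD (c * i + j) d = (f L[i]).getD j d := by
  induction L with
  | nil => intro i j hi; simp at hi
  | cons a L ih =>
    intro i j hi hj
    have ha : (f a).length = c := hf a (by simp)
    rw [List.flatMap_cons]
    cases i with
    | zero =>
      rw [Nat.mul_zero, Nat.zero_add, List.getD_append _ _ _ _ (by omega)]
      rfl
    | succ i =>
      rw [List.getD_append_right _ _ _ _ (by rw [ha]; nlinarith), ha,
        show c * (i + 1) + j - c = c * i + j by rw [Nat.mul_add]; omega,
        ih (fun b hb => hf b (by simp [hb])) (by simpa using hi) hj]
      rfl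

/-! ### The token functions evaluated on an encoded automaton. -/

section Spec

variable {k : ℕ} (A : DetAut k)

open Tok

@[simp] theorem letters_autTokens : letters (autTokens A) = k := by simp [letters, autTokens]

@[simp] theorem states_autTokens : states (autTokens A) = A.numStates := by
  simp [states, autTokens]

@[simp] theorem init_autTokens : Tok.init (autTokens A) = A.aut.init := by
  simp [Tok.init, autTokens]

@[simp] theorem trans_autTokens : Tok.trans (autTokens A) = A.numStates * k := by simp [Tok.trans]

theorem idx_autTokens (q : Fin A.numStates) (a : Fin k) :
    idx (autTokens A) q a = (finProdFinEquiv (q, a) : ℕ) := by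
  simp [idx, finProdFinEquiv, mul_comm, add_comm]

/-- Three header tokens precede blocks of three tokens per transition, ordered by state and then
letter. -/
theorem getD_autTokens (q : Fin A.numStates) (a : Fin k) {j : ℕ} (hj : j < 3) :
    (autTokens A).getD (3 * idx (autTokens A) q a + (3 + j)) [] =
      (transTokens (A.trans q a).1 (A.trans q a).2).getD j [] := by
  have h₁ : ∀ q : Fin A.numStates, ∀ a ∈ List.finRange k,
      (transTokens (A.trans q a).1 (A.trans q a).2).length = 3 := fun _ _ _ => rfl
  have h₂ : ∀ q ∈ List.finRange A.numStates, ((List.finRange k).flatMap fun a =>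
      transTokens (A.trans q a).1 (A.trans q a).2).length = 3 * k := by
    intro q _
    simp [List.length_flatMap, transTokens, mul_comm]
  have h₃ : 3 * (a : ℕ) + j < 3 * k := by have := a.2; omega
  rw [show 3 * idx (autTokens A) q a + (3 + j) = 3 * k * q + (3 * a + j) + 1 + 1 + 1 by
    simp [idx]; ring]
  rw [autTokens, List.getD_cons_succ, List.getD_cons_succ, List.getD_cons_succ,
    List.getD_flatMap_of_length_eq h₂ _ (by simp) h₃,
    List.getD_flatMap_of_length_eq (h₁ _) _ (by simp) hj]
  simp

theorem num_autTokens (q : Fin A.numStates) (a : Fin k) :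
    num (autTokens A) (idx (autTokens A) q a) =
      decide ((A.trans q a).1 < 0) :: encodeNat (A.trans q a).1.num.natAbs :=
  getD_autTokens A q a (j := 0) (by omega)

theorem den_autTokens (q : Fin A.numStates) (a : Fin k) :
    den (autTokens A) (idx (autTokens A) q a) = encodeNat (A.trans q a).1.den :=
  getD_autTokens A q a (j := 1) (by omega)

theorem succ_autTokens (q : Fin A.numStates) (a : Fin k) :
    succ (autTokens A) (idx (autTokens A) q a) = (A.trans q a).2 := by
  have h := getD_autTokens A q a (j := 2) (by omega)
  rw [succ]
  exact (congrArg List.length h).trans (by simp [transTokens])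

/-- The weight of a transition given by its number. -/
noncomputable def DetAut.weightOf (t : ℕ) : ℚ :=
  if h : t < A.numStates * k then
    (A.trans (finProdFinEquiv.symm ⟨t, h⟩).1 (finProdFinEquiv.symm ⟨t, h⟩).2).1
  else 0

theorem exists_idx_eq {t : ℕ} (h : t < A.numStates * k) :
    ∃ (q : Fin A.numStates) (a : Fin k), t = idx (autTokens A) q a :=
  ⟨(finProdFinEquiv.symm ⟨t, h⟩).1, (finProdFinEquiv.symm ⟨t, h⟩).2, by
    rw [idx_autTokens, Prod.mk.eta, Equiv.apply_symm_apply]⟩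

theorem idx_autTokens_lt (q : Fin A.numStates) (a : Fin k) :
    idx (autTokens A) q a < A.numStates * k := by
  rw [idx_autTokens]
  exact Fin.is_lt _

theorem weightOf_idx (q : Fin A.numStates) (a : Fin k) :
    A.weightOf (idx (autTokens A) q a) = (A.trans q a).1 := by
  rw [DetAut.weightOf, dif_pos (idx_autTokens_lt A q a)]
  have : (⟨idx (autTokens A) q a, idx_autTokens_lt A q a⟩ : Fin (A.numStates * k)) =
      finProdFinEquiv (q, a) := Fin.ext (idx_autTokens A q a)
  rw [this, Equiv.symm_apply_apply]

theorem weightLe_autTokens : ∀ s < Tok.trans (autTokens A), ∀ t < Tok.trans (autTokens A),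
    weightLe (autTokens A) s t = true ↔ A.weightOf s ≤ A.weightOf t := by
  intro s hs t ht
  rw [trans_autTokens] at hs ht
  obtain ⟨q, a, rfl⟩ := exists_idx_eq A hs
  obtain ⟨q', a', rfl⟩ := exists_idx_eq A ht
  rw [weightOf_idx, weightOf_idx, Rat.le_iff_natAbs, weightLe, num_autTokens, num_autTokens,
    den_autTokens, den_autTokens]
  by_cases h₁ : (A.trans q a).1 < 0 <;> by_cases h₂ : (A.trans q' a').1 < 0 <;>
    simp [h₁, h₂, bleList_iff, bval_bmul, bval_encodeNat]

/-- A maximizing letter either attains the value at once or is prepended to a word that attains it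
from the successor. The alternative 0 covers the initial table and the empty alphabet. -/
theorem exists_rank_eq_bestUpTo (i : ℕ) (q : Fin A.numStates) :
    bestUpTo (autTokens A) i q = 0 ∨ ∃ (w : ℕ → Fin k) (j : ℕ),
      rank (autTokens A) (idx (autTokens A) (A.runFrom q w j) (w j)) =
        bestUpTo (autTokens A) i q := by
  induction i generalizing q with
  | zero => exact .inl (bestUpTo_zero _ _)
  | succ i ih =>
    rw [bestUpTo_succ _ (by simp)]
    rcases (Finset.range (letters (autTokens A))).eq_empty_or_nonempty with h | h
    · exact .inl (by rw [h]; rfl)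
    obtain ⟨a, ha, e⟩ := Finset.exists_mem_eq_sup _ h fun a =>
      max (rank (autTokens A) (idx (autTokens A) q a))
        (bestUpTo (autTokens A) i (succ (autTokens A) (idx (autTokens A) q a)))
    rw [e]
    simp only [letters_autTokens, Finset.mem_range] at ha
    have hs := succ_autTokens A q ⟨a, ha⟩
    dsimp only at hs
    rw [hs]
    rcases max_choice (rank (autTokens A) (idx (autTokens A) q a))
      (bestUpTo (autTokens A) i (A.trans q ⟨a, ha⟩).2) with h | h
    · exact .inr ⟨fun _ => ⟨a, ha⟩, 0, h.symm⟩
    · rw [h]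
      refine (ih _).imp_right ?_
      rintro ⟨w, j, hw⟩
      refine ⟨fun l => Nat.casesOn l ⟨a, ha⟩ w, j + 1, ?_⟩
      rw [add_comm j 1, A.runFrom_shift]
      simp only [add_comm 1]
      exact hw

/-- The ranking of the weights of an automaton. -/
noncomputable def ranking : A.Ranking where
  rank q a := rank (autTokens A) (idx (autTokens A) q a)
  best q := best (autTokens A) q
  top := A.numStates * k
  weight r := A.weightOf (sel (autTokens A) r)
  rank_le_top q a := by simpa using rank_le (autTokens A) (idx (autTokens A) q a)
  weight_rank q a := by
    rw [wt_sel (weightLe_autTokens A) (by simpa using idx_autTokens_lt A q a), weightOf_idx]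
  weight_mono q a q' a' h := by
    rwa [rank_le_rank_iff (weightLe_autTokens A) (by simpa using idx_autTokens_lt A q a)
      (by simpa using idx_autTokens_lt A q' a'), weightOf_idx, weightOf_idx] at h
  weight_le_top q a := by
    have h : idx (autTokens A) q a < Tok.trans (autTokens A) := by
      simpa using idx_autTokens_lt A q a
    obtain ⟨s, hs, e, hmax⟩ := exists_rank_eq_trans (weightLe_autTokens A) h
    rw [← trans_autTokens, ← e, wt_sel (weightLe_autTokens A) hs, ← weightOf_idx]
    exact hmax _ h
  rank_le_best q a := rank_le_best _ (by simp) (by simp)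
  best_succ_le q a := by
    rw [← succ_autTokens]
    exact best_succ_le _ (by simp) (by simp)
  exists_rank_eq_best q a := by
    -- The best rank is not 0, since it dominates the rank of a transition, and a transition counts
    -- itself.
    refine (exists_rank_eq_bestUpTo A _ q).resolve_left fun h => ?_
    have h₁ := rank_pos (weightLe_autTokens A) (t := idx (autTokens A) q a)
      (by simpa using idx_autTokens_lt A q a)
    have h₂ := rank_le_best (autTokens A) (q := q) (a := a) (by simp) (by simp)
    rw [best_eq, h] at h₂
    omega

/-! ### The output -/

theorem map_tokSymb (l : List Bool) :
    (tokSymb l).map Symb.toΓ' = l.map Γ'.bit ++ [Γ'.comma] := by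
  simp [tokSymb, Symb.toΓ']

theorem map_unarySymb (n : ℕ) : (unarySymb n).map Symb.toΓ' = encUnary n := by
  simp [unarySymb, map_tokSymb, encUnary]

theorem map_weight_tokens (q : Fin A.numStates) (a : Fin k) :
    (tokSymb (num (autTokens A) (idx (autTokens A) q a)) ++
      tokSymb (den (autTokens A) (idx (autTokens A) q a))).map Symb.toΓ' =
      encRat (A.trans q a).1 := by
  rw [List.map_append, map_tokSymb, map_tokSymb, num_autTokens, den_autTokens]
  simp [encRat, encBinary]

theorem List.flatMap_range_eq {β : Type} (n : ℕ) (f : ℕ → List β) :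
    (List.range n).flatMap f = (List.finRange n).flatMap fun i : Fin n => f i := by
  rw [← List.map_coe_finRange_eq_range, List.flatMap_map]

/-- `finProdFinEquiv` numbers pairs lexicographically, so nested loops list the states of the
product in the order of their numbers. -/
theorem List.finRange_mul (m n : ℕ) : List.finRange (m * n) =
    (List.finRange m).flatMap fun i => (List.finRange n).map fun j => finProdFinEquiv (i, j) := by
  apply List.map_injective_iff.2 Fin.val_injective
  rw [List.map_coe_finRange_eq_range, List.map_flatMap]
  have : ∀ i : Fin m, ((List.finRange n).map fun j => finProdFinEquiv (i, j)).map Fin.val =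
      (List.range n).map fun j => n * i + j := by
    intro i
    rw [← List.map_coe_finRange_eq_range, List.map_map, List.map_map]
    simp [Function.comp_def, finProdFinEquiv, add_comm]
  simp only [this]
  rw [← List.flatMap_range_eq m fun i => (List.range n).map fun j => n * i + j]
  clear this
  induction m with
  | zero => simp
  | succ m ih =>
    rw [List.range_succ, List.flatMap_append, Nat.succ_mul, List.range_add, ih]
    simp [mul_comm]

theorem List.flatMap_finRange_mul {β : Type} (m n : ℕ) (g : Fin (m * n) → List β) :
    (List.finRange (m * n)).flatMap g = (List.finRange m).flatMap fun i =>
      (List.finRange n).flatMap fun j => g (finProdFinEquiv (i, j)) := by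
  simp only [List.finRange_mul, List.flatMap_assoc, List.flatMap_map]

theorem trans_prod (R : A.Ranking) (r : ℕ → Fin A.numStates → Fin k → ℕ) (m : Fin (R.top + 1))
    (q : Fin A.numStates) (a : Fin k) :
    ((R.prod r).trans (finProdFinEquiv (m, q)) a).1 = R.weight (r m q a) ∧
      (((R.prod r).trans (finProdFinEquiv (m, q)) a).2 : ℕ) =
        max (m : ℕ) (R.rank q a) * A.numStates + (A.trans q a).2 := by
  have h := (R.prod r).δ_eq (finProdFinEquiv (m, q)) a
  have h' := Finset.singleton_injective h
  rw [← h']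
  simp only [Equiv.symm_apply_apply, true_and]
  simp [finProdFinEquiv, mul_comm, add_comm]

/-- Every weight of the product is the weight of some transition of `A`. Its tokens are copied from
the input and hence are already in lowest terms. -/
theorem map_outSymb (r : ℕ → Fin A.numStates → Fin k → ℕ) (r' : ℕ → ℕ → ℕ → ℕ)
    (h : ∀ m q a, r m q a = r' m q a) :
    (outSymb (autTokens A) r').map Symb.toΓ' = encAut ((ranking A).prod r) := by
  have hn : encUnary ((ranking A).prod r).numStates =
      encUnary ((A.numStates * k + 1) * A.numStates) := rfl
  have hi : (((ranking A).prod r).aut.init : ℕ) = A.aut.init := by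
    simp [DetAut.Ranking.prod, finProdFinEquiv]
  rw [encAut, hi, hn, outSymb]
  simp only [List.map_append, map_unarySymb, prodStates, trans_autTokens, letters_autTokens,
    states_autTokens, init_autTokens, List.map_flatMap]
  congr 3
  refine Eq.trans ?_ (List.flatMap_finRange_mul (A.numStates * k + 1) A.numStates _).symm
  rw [List.flatMap_range_eq]
  refine List.flatMap_congr fun m _ => ?_
  rw [List.flatMap_range_eq]
  refine List.flatMap_congr fun q _ => ?_
  rw [List.flatMap_range_eq]
  refine List.flatMap_congr fun a _ => ?_
  have hpos : 0 < Tok.trans (autTokens A) :=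
    (Nat.zero_le _).trans_lt (by simpa using idx_autTokens_lt A q a)
  -- For a rank that no transition has, `sel` returns the default 0, still the number of a
  -- transition.
  obtain ⟨q', a', e⟩ := exists_idx_eq A (t := sel (autTokens A) (r' m q a))
    (by simpa using sel_lt (autTokens A) hpos)
  obtain ⟨h₁, h₂⟩ := trans_prod A (ranking A) r m q a
  have hw : (ranking A).weight (r m q a) = (A.trans q' a').1 := by
    rw [← weightOf_idx, ← e, ← h]
    rfl
  refine Eq.trans ?_ (congrArg₂ (fun x n => encRat x ++ encUnary n) (h₁.trans hw) h₂).symm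
  rw [← List.map_append, e, map_weight_tokens, prodState, nextRank, succ_autTokens,
    states_autTokens]
  rfl

end Spec

theorem mainTheorem6 :
    ∃ B C : (k : ℕ) → DetAut k → DetAut k,
      Nonempty (TM2ComputableInPolyTime encInput encOutput
        (fun A : Σ k : ℕ, DetAut k =>
          (⟨A.1, B A.1 A.2, C A.1 A.2⟩ : Σ k : ℕ, DetAut k × DetAut k))) ∧
      ∀ (k : ℕ) (A : DetAut k),
        IsSafe ((B k A).aut.value infVal) ∧
        IsLive ((C k A).aut.value supVal) ∧
        ∀ w : ℕ → Fin k,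
          A.aut.value supVal w = min ((B k A).aut.value infVal w) ((C k A).aut.value supVal w) := by
  refine ⟨fun _ A => (ranking A).safe, fun _ A => (ranking A).live, ?_, fun k A =>
    ⟨(ranking A).safe.isSafe_infVal, (ranking A).isLive_live, (ranking A).value_eq_min⟩⟩
  -- Writing to the output stack reverses the list, so it is reversed beforehand.
  refine (PolyTime.list_reverse (PolyTime.decompSymb.comp PolyTime.tokens)).computable ?_
  rintro ⟨k, A⟩
  rw [List.map_reverse, encInput, tokens_encAut, decompSymb, List.map_append,
    map_outSymb A (ranking A).safeRank _ fun _ _ _ => rfl,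
    map_outSymb A (ranking A).liveRank _ fun m q a => ?_]
  · rfl
  · rw [Tok.liveRank, succ_autTokens, trans_autTokens]
    simp only [Nat.ble_eq]
    rfl
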